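/- Consider the classical Cramér–Lundberg risk model with premium rate $1$: claims arrive according to a Poisson process $\{N_\epsilon(t)\}_{t\ge 0}$ with rate $\lambda>0$, and the claim sizes $U_{\epsilon,1},U_{\epsilon,2},\dots$ are i.i.d., independent of $\{N_\epsilon(t)\}$. Here $\epsilon\in(0,1]$, and each claim size has the mixture distribution $G_\epsilon=(1-\epsilon)F_B+\epsilon F_C$, where $F_B$ is the distribution of a phase-type random variable $B$ and $F_C$ is the distribution of a nonnegative random variable $C$, both with finite mean. For initial capital $u$, let $\psi_\epsilon(u)$ be the ruin probability, i.e. the probability that the reserve $R_\epsilon(t)=u+t-\sum_{i=1}^{N_\epsilon(t)}U_{\epsilon,i}$ is negative for some $t\ge 0$. Put $\delta=\lambda\,\mathbb{E}B$ and $\theta=\lambda\,\mathbb{E}C$, and assume that $\rho_\epsilon=(1-\epsilon)\delta+\epsilon\theta<1$. Let $C^e$ have the stationary excess distribution of $C$, $\mathbb{P}(C^e\le u)=\frac{1}{\mathbb{E}C}\int_0^u\mathbb{P}(C>t)\,dt$ for $u\ge0$. Suppose that the distribution $F$ of $C^e$ is subexponential, that is, $\lim_{u\to\infty}\frac{1-F^{*n}(u)}{1-F(u)}=n$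 for every $n=1,2,\dots$, where $F^{*n}$ is the $n$-fold convolution of $F$. Then \[ \lim_{u\to\infty}\frac{\psi_\epsilon(u)}{\dfrac{\epsilon\theta}{1-\delta+\epsilon\delta-\epsilon\theta}\,\mathbb{P}(C^e>u)}=1 . \] -/

import Mathlib

open MeasureTheory ProbabilityTheory Filter Topology
open scoped NNReal ENNReal Matrix

noncomputable section

/-- Tail (complementary distribution function) `u ↦ F (u, ∞)` of a distribution `F` on `ℝ`. -/
def tail (F : Measure ℝ) (u : ℝ) : ℝ := F.real (Set.Ioi u)

/-- Mean of a distribution `F` on `ℝ`. -/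
def mean (F : Measure ℝ) : ℝ := ∫ x, x ∂F

/-- `n`-fold convolution of `F` with itself. -/
def convPow (F : Measure ℝ) : ℕ → Measure ℝ
  | 0 => Measure.dirac 0
  | n + 1 => Measure.conv (convPow F n) F

/-- Stationary excess distribution `F^e (u) = (1 / mean F) ∫_0^u (1 - F (t)) dt` of a distribution
`F` on `[0, ∞)` with finite positive mean, given through its density. -/
def stationaryExcess (F : Measure ℝ) : Measure ℝ :=
  (volume.restrict (Set.Ioi 0)).withDensity fun t => ENNReal.ofReal (tail F t / mean F)

/-- `F` is a probability distribution concentrated on `[0, ∞)`. -/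
structure IsNonnegDistribution (F : Measure ℝ) : Prop where
  isProbabilityMeasure : IsProbabilityMeasure F
  nonneg : F (Set.Iio 0) = 0

/-- The class of subexponential distributions. -/
structure IsSubexponential (F : Measure ℝ) : Prop where
  isNonnegDistribution : IsNonnegDistribution F
  tendsto : ∀ n : ℕ, 1 ≤ n →
    Tendsto (fun u : ℝ => tail (convPow F n) u / tail F u) atTop (𝓝 (n : ℝ))

/-- Phase-type distributions: `F` is the law of the absorption time of a Markov jump process with
`m` transient states and one absorbing state. `T` is the (nonsingular) subintensity matrix of the
transient states and `α` is the initial law restricted to them; the remaining initial mass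
`1 - ∑ i, α i` is an atom at `0`. The process is still in a transient state at time `x` with
probability `α exp (x T) 1`. -/
def IsPhaseType (F : Measure ℝ) : Prop :=
  IsNonnegDistribution F ∧
  ∃ (m : ℕ) (α : Fin m → ℝ) (T : Matrix (Fin m) (Fin m) ℝ),
    (∀ i, 0 ≤ α i) ∧ ∑ i, α i ≤ 1 ∧
    (∀ i j, i ≠ j → 0 ≤ T i j) ∧ (∀ i, ∑ j, T i j ≤ 0) ∧ T.det ≠ 0 ∧
    ∀ x : ℝ, 0 ≤ x → tail F x = α ⬝ᵥ (NormedSpace.exp (x • T) *ᵥ fun _ => 1)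

/-- The law of a random variable that has law `F` with probability `1 - ε` and law `H` with
probability `ε`. -/
def mixture (ε : ℝ) (F H : Measure ℝ) : Measure ℝ :=
  ENNReal.ofReal (1 - ε) • F + ENNReal.ofReal ε • H

/-- `N` is a Poisson process with rate `lam`: almost surely `N t` counts the arrivals in `[0, t]`
for all `t`, where the times between successive arrivals are i.i.d. exponential with rate `lam`. -/
def IsPoissonProcess {Ω : Type*} [MeasurableSpace Ω] (N : ℝ≥0 → Ω → ℕ) (lam : ℝ)
    (P : Measure Ω) : Prop :=
  ∃ τ : ℕ → Ω → ℝ, (∀ n, HasLaw (τ n) (expMeasure lam) P) ∧ iIndepFun τ P ∧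
    ∀ᵐ ω ∂P, ∀ t : ℝ≥0,
      N t ω = Set.ncard {n : ℕ | ∑ i ∈ Finset.range (n + 1), τ i ω ≤ (t : ℝ)}

/-- The ingredients of the Cramér–Lundberg model: claims arrive according to a Poisson process `N`
with rate `lam`, the claim sizes `X 0, X 1, …` are i.i.d. with law `G`, and the sequence of claim
sizes is independent of the process `N`. -/
structure IsCramerLundberg {Ω : Type*} [MeasurableSpace Ω] (N : ℝ≥0 → Ω → ℕ) (X : ℕ → Ω → ℝ)
    (lam : ℝ) (G : Measure ℝ) (P : Measure Ω) : Prop where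
  poisson : IsPoissonProcess N lam P
  hasLaw : ∀ i, HasLaw (X i) G P
  iIndep : iIndepFun X P
  indep : IndepFun (fun ω t => N t ω) (fun ω i => X i ω) P

/-- Risk reserve at time `t` for initial capital `u` and premium rate `1`. -/
def reserve {Ω : Type*} (N : ℝ≥0 → Ω → ℕ) (X : ℕ → Ω → ℝ) (u : ℝ) (t : ℝ≥0) (ω : Ω) : ℝ :=
  u + (t : ℝ) - ∑ i ∈ Finset.range (N t ω), X i ω

/-- Probability of ultimate ruin: the reserve ever drops below zero. -/
def ruinProbability {Ω : Type*} [MeasurableSpace Ω] (P : Measure Ω) (N : ℝ≥0 → Ω → ℕ)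
    (X : ℕ → Ω → ℝ) (u : ℝ) : ℝ :=
  P.real {ω | ∃ t : ℝ≥0, reserve N X u t ω < 0}

end

/-!
# Ruin probabilities for mixtures of phase-type and subexponential claims

Ruin can only occur at a claim epoch, so the ruin probability `ψ u` is the probability that the
random walk with steps "claim minus exponential waiting time" ever exceeds `u`. The interarrival
times are recovered measurably from the counting process, which makes the steps i.i.d.
(`IsCramerLundberg.ruinProbability_eq`).

Conditioning on the first step shows that the survival probability `φ = 1 - ψ` is an exponential
average of `φ * G`, where `G` is the claim law; it therefore solves `φ' = lam (φ - φ * G)` in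
integrated form. Fubini's theorem turns this into `φ u = φ 0 + ∫ φ (u - x) L (dx)`, where `L` has
density `lam * tail G` on `(0, ∞)`. By the strong law of large numbers `φ → 1` at infinity, which
identifies `φ 0`, and `ψ u = ∫ ψ (u - x) L (dx)` for `u ≥ 0` (`one_sub_survival_eq_integral`).
This is a defective renewal equation, `L` having mass `ρ < 1`. The Pollaczek-Khinchine series
for its solution, and bounds for convolution powers, are not needed: the asymptotics are read off
from the equation itself.

For the mixture, `L = κ + a F` with `a = ε θ`, `F` the stationary excess distribution of the
heavy-tailed claims and `κ` a measure with an exponential moment, because phase-type tails decay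
exponentially (`IsPhaseType.exists_tail_le`). A subexponential `F` is long-tailed
(`IsSubexponential.tendsto_tail_sub`) and so decays more slowly than any exponential; hence
`tail L / tail F → a` and `(∫ tail F (u - x) L (dx)) / tail F u → a + ρ`. These two limits make
`c * tail F` with `c = a / (1 - ρ)` an approximate solution of the renewal equation, up to an error
`o (tail F)`. The difference `D = ψ - c * tail F` then satisfies `|D| ≤ o (tail F) + |D| * L`, and
since `ρ < 1` this forces `D = o (tail F)` (`tendsto_zero_of_renewal_inequality`).
-/

/-! ### Tails -/

lemma tail_nonneg (F : Measure ℝ) (u : ℝ) : 0 ≤ tail F u := measureReal_nonneg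

lemma tail_antitone (F : Measure ℝ) [IsFiniteMeasure F] : Antitone (tail F) := fun _ _ h =>
  measureReal_mono (Set.Ioi_subset_Ioi h)

lemma measurable_tail (F : Measure ℝ) [IsFiniteMeasure F] : Measurable (tail F) :=
  (tail_antitone F).measurable

lemma tail_le_one (F : Measure ℝ) [IsProbabilityMeasure F] (u : ℝ) : tail F u ≤ 1 :=
  measureReal_le_one

lemma tail_of_neg {F : Measure ℝ} (hF : F (Set.Iio 0) = 0) {u : ℝ} (hu : u < 0) :
    tail F u = F.real Set.univ := by
  have : F (Set.Iic u) = 0 := measure_mono_null (fun x hx => lt_of_le_of_lt hx hu) hF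
  have h2 := measureReal_congr (μ := F) (s := Set.Ioi u) (t := Set.univ)
    (by rw [← Set.compl_Iic]; exact ae_eq_univ.2 (by simpa using this))
  exact h2

lemma ae_nonneg_of_measure_Iio {F : Measure ℝ} (hF : F (Set.Iio 0) = 0) : ∀ᵐ x ∂F, 0 ≤ x := by
  rw [ae_iff]; simp only [not_le]; exact hF

lemma integrable_of_bounded {L : Measure ℝ} [IsFiniteMeasure L] {f : ℝ → ℝ} (hf : Measurable f)
    {C : ℝ} (hC : ∀ x, |f x| ≤ C) : Integrable f L :=
  Integrable.of_bound hf.aestronglyMeasurable C (Eventually.of_forall fun x => hC x)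

/-! ### Defective renewal inequalities -/

section Renewal

variable {L : Measure ℝ} [IsFiniteMeasure L] {w e D : ℝ → ℝ} {ρ C : ℝ}

lemma setIntegral_shift_le (hL : L (Set.Iio 0) = 0) (hw : Antitone w) (hw0 : ∀ u, 0 < w u)
    (hw1 : ∀ u, w u ≤ 1) (hD : Measurable D) (hDC : ∀ u, |D u| ≤ C) {s : Set ℝ}
    (hs : MeasurableSet s) {u K : ℝ} (h : ∀ x ∈ s, 0 ≤ x → |D (u - x)| ≤ K * w (u - x)) :
    ∫ x in s, |D (u - x)| ∂L ≤ K * ∫ x in s, w (u - x) ∂L := by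
  rw [← integral_const_mul]
  apply integral_mono_ae
  · exact integrable_of_bounded (C := C) (by fun_prop) (fun x => by simpa using hDC _)
  · exact integrable_of_bounded (C := |K| * 1) (by have := hw.measurable; fun_prop)
      (fun x => by
        rw [abs_mul, abs_of_pos (hw0 _)]
        exact mul_le_mul_of_nonneg_left (hw1 _) (abs_nonneg _))
  · filter_upwards [ae_restrict_mem hs, ae_restrict_of_ae (ae_nonneg_of_measure_Iio hL)]
      with x hx hx0 using h x hx hx0

/-- On `[0, U]` the supremum `S` of `|D| / w` is finite, and the inequality gives
`S ≤ 1 + r S` with `r < 1` up to the values near the origin, which bounds `S` uniformly in `U`. -/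
lemma exists_bound_of_renewal_inequality (hL : L (Set.Iio 0) = 0) (hw : Antitone w)
    (hw0 : ∀ u, 0 < w u) (hw1 : ∀ u, w u ≤ 1) (hD : Measurable D) (hDC : ∀ u, |D u| ≤ C)
    (hρ : ρ < 1)
    (hineq : ∀ u, 0 ≤ u → |D u| ≤ e u + ∫ x in Set.Iic u, |D (u - x)| ∂L)
    (he : Tendsto (fun u => e u / w u) atTop (𝓝 0))
    (hJ : Tendsto (fun u => (∫ x in Set.Iic u, w (u - x) ∂L) / w u) atTop (𝓝 ρ)) :
    ∃ K, ∀ u, 0 ≤ u → |D u| / w u ≤ K := by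
  have hC0 : 0 ≤ C := (abs_nonneg _).trans (hDC 0)
  obtain ⟨r, hr, hr1⟩ := exists_between hρ
  have hev := (he.eventually (gt_mem_nhds one_pos)).and (hJ.eventually (gt_mem_nhds hr))
  obtain ⟨u₀, hu₀⟩ := eventually_atTop.1 hev
  refine ⟨max (C / w (max u₀ 0)) (1 / (1 - r)), fun U hU => ?_⟩
  set g : ℝ → ℝ := fun u => |D u| / w u
  have hbound : ∀ {u V}, u ≤ V → g u ≤ C / w V := fun {u V} h =>
    div_le_div₀ hC0 (hDC u) (hw0 V) (hw h)
  have hbdd : BddAbove (g '' Set.Icc 0 U) := by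
    refine ⟨C / w U, ?_⟩
    rintro _ ⟨u, hu, rfl⟩
    exact hbound hu.2
  set S := sSup (g '' Set.Icc 0 U)
  have hgS : ∀ u ∈ Set.Icc 0 U, g u ≤ S := fun u hu => le_csSup hbdd ⟨u, hu, rfl⟩
  have hS0 : 0 ≤ S := le_trans (div_nonneg (abs_nonneg _) (hw0 _).le) (hgS U ⟨hU, le_rfl⟩)
  have key : S ≤ max (C / w (max u₀ 0)) (1 + r * S) := by
    refine csSup_le ⟨_, 0, ⟨le_rfl, hU⟩, rfl⟩ ?_
    rintro _ ⟨u, hu, rfl⟩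
    rcases le_total u (max u₀ 0) with h | h
    · exact le_max_of_le_left (hbound h)
    · refine le_max_of_le_right ?_
      obtain ⟨h1, h2⟩ := hu₀ u ((le_max_left _ _).trans h)
      have h3 : ∫ x in Set.Iic u, |D (u - x)| ∂L ≤ S * ∫ x in Set.Iic u, w (u - x) ∂L := by
        refine setIntegral_shift_le hL hw hw0 hw1 hD hDC measurableSet_Iic fun x hx hx0 => ?_
        have hx' : x ≤ u := hx
        exact (div_le_iff₀ (hw0 _)).1 (hgS (u - x) ⟨by linarith, by linarith [hu.2]⟩)
      have h4 : g u ≤ e u / w u + S * ((∫ x in Set.Iic u, w (u - x) ∂L) / w u) := by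
        rw [← mul_div_assoc, ← add_div]
        exact div_le_div_of_nonneg_right ((hineq u hu.1).trans (by linarith)) (hw0 u).le
      have h5 := mul_le_mul_of_nonneg_left h2.le hS0
      linarith
  refine (hgS U ⟨hU, le_rfl⟩).trans ?_
  rcases le_max_iff.1 key with h | h
  · exact le_max_of_le_left h
  · refine le_max_of_le_right ?_
    rw [le_div_iff₀ (by linarith)]
    linarith

/-- A bounded solution of the renewal inequality `|D| ≤ e + |D| * L` with a defective kernel `L`
is negligible with respect to `w` when `e` is: the limit superior `R` of `|D| / w` is finite and
satisfies `R ≤ ρ R`. -/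
lemma tendsto_zero_of_renewal_inequality (hL : L (Set.Iio 0) = 0) (hw : Antitone w)
    (hw0 : ∀ u, 0 < w u) (hw1 : ∀ u, w u ≤ 1) (hD : Measurable D) (hDC : ∀ u, |D u| ≤ C)
    (hρ0 : 0 ≤ ρ) (hρ : ρ < 1)
    (hineq : ∀ u, 0 ≤ u → |D u| ≤ e u + ∫ x in Set.Iic u, |D (u - x)| ∂L)
    (he : Tendsto (fun u => e u / w u) atTop (𝓝 0))
    (hJ : Tendsto (fun u => (∫ x in Set.Iic u, w (u - x) ∂L) / w u) atTop (𝓝 ρ))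
    (hlast : ∀ M, 0 ≤ M → Tendsto (fun u => L.real (Set.Ioc (u - M) u) / w u) atTop (𝓝 0)) :
    Tendsto (fun u => D u / w u) atTop (𝓝 0) := by
  obtain ⟨K₀, hK₀⟩ := exists_bound_of_renewal_inequality hL hw hw0 hw1 hD hDC hρ hineq he hJ
  set g : ℝ → ℝ := fun u => |D u| / w u with hg
  have hg0 : ∀ u, 0 ≤ g u := fun u => div_nonneg (abs_nonneg _) (hw0 u).le
  have hK₀0 : 0 ≤ K₀ := (hg0 0).trans (hK₀ 0 le_rfl)
  -- one step of the contraction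
  have step : ∀ K, 0 ≤ K → (∀ᶠ u in atTop, g u ≤ K) → ∀ η, 0 < η →
      ∀ᶠ u in atTop, g u ≤ ρ * K + η := by
    intro K hK hgK η hη
    obtain ⟨M, hM⟩ := eventually_atTop.1 hgK
    have hlim := (he.add (hJ.const_mul K)).add ((hlast (max M 0) (le_max_right _ _)).const_mul K₀)
    have hlt : 0 + K * ρ + K₀ * 0 < ρ * K + η := by linarith
    filter_upwards [hlim.eventually (gt_mem_nhds hlt), eventually_ge_atTop (max M 0)] with u h1 hu
    have hu0 : 0 ≤ u := (le_max_right _ _).trans hu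
    set m := max M 0
    have hm0 : 0 ≤ m := le_max_right _ _
    have hsplit : Set.Iic u = Set.Iic (u - m) ∪ Set.Ioc (u - m) u := by
      rw [Set.Iic_union_Ioc_eq_Iic (by linarith)]
    have hint : ∀ s, IntegrableOn (fun x => |D (u - x)|) s L := fun s =>
      integrable_of_bounded (C := C) (by fun_prop) (fun x => by simpa using hDC _)
    have hwi : ∀ s, IntegrableOn (fun x => w (u - x)) s L := fun s =>
      integrable_of_bounded (C := 1) (by have := hw.measurable; fun_prop)
        (fun x => by rw [abs_of_pos (hw0 _)]; exact hw1 _)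
    have e1 : ∫ x in Set.Iic (u - m), |D (u - x)| ∂L ≤ K * ∫ x in Set.Iic u, w (u - x) ∂L := by
      refine (setIntegral_shift_le (K := K) hL hw hw0 hw1 hD hDC measurableSet_Iic
        fun x hx hx0 => ?_).trans ?_
      · have hx' : x ≤ u - m := hx
        exact (div_le_iff₀ (hw0 _)).1 (hM (u - x) ((le_max_left M 0).trans (by linarith)))
      · refine mul_le_mul_of_nonneg_left ?_ hK
        exact setIntegral_mono_set (hwi _) (Eventually.of_forall fun x => (hw0 _).le)
          (Set.Iic_subset_Iic.2 (by linarith)).eventuallyLE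
    have e2 : ∫ x in Set.Ioc (u - m) u, |D (u - x)| ∂L ≤ K₀ * L.real (Set.Ioc (u - m) u) := by
      refine (setIntegral_shift_le (K := K₀) hL hw hw0 hw1 hD hDC measurableSet_Ioc
        fun x hx hx0 => ?_).trans ?_
      · exact (div_le_iff₀ (hw0 _)).1 (hK₀ (u - x) (by linarith [hx.2]))
      · refine mul_le_mul_of_nonneg_left ?_ hK₀0
        calc ∫ x in Set.Ioc (u - m) u, w (u - x) ∂L
            ≤ ∫ x in Set.Ioc (u - m) u, (1 : ℝ) ∂L :=
              integral_mono (hwi _) (integrable_const _) fun x => hw1 _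
          _ = _ := by simp
    have e3 : |D u| ≤ e u + (K * ∫ x in Set.Iic u, w (u - x) ∂L)
        + K₀ * L.real (Set.Ioc (u - m) u) := by
      have := hineq u hu0
      rw [hsplit, setIntegral_union (Set.Iic_disjoint_Ioc le_rfl)
        measurableSet_Ioc (hint _) (hint _)] at this
      linarith
    have e4 : g u ≤ e u / w u + K * ((∫ x in Set.Iic u, w (u - x) ∂L) / w u)
        + K₀ * (L.real (Set.Ioc (u - m) u) / w u) := by
      rw [← mul_div_assoc, ← mul_div_assoc, ← add_div, ← add_div]
      exact div_le_div_of_nonneg_right e3 (hw0 u).le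
    exact e4.trans h1.le
  -- the least eventual bound vanishes
  set A : Set ℝ := {K | 0 ≤ K ∧ ∀ᶠ u in atTop, g u ≤ K} with hA
  have hAne : A.Nonempty := ⟨K₀, hK₀0, (eventually_ge_atTop 0).mono hK₀⟩
  have hAbdd : BddBelow A := ⟨0, fun K hK => hK.1⟩
  have hR0 : 0 ≤ sInf A := le_csInf hAne fun K hK => hK.1
  have hR : sInf A = 0 := by
    have h1 : ∀ K ∈ A, sInf A ≤ ρ * K := fun K hK =>
      le_of_forall_pos_le_add fun η hη => csInf_le hAbdd
        ⟨by have := mul_nonneg hρ0 hK.1; linarith, step K hK.1 hK.2 η hη⟩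
    by_contra hne
    have hpos : 0 < sInf A := lt_of_le_of_ne hR0 (Ne.symm hne)
    have h2 : ∀ η, 0 < η → sInf A ≤ ρ * (sInf A + η) := fun η hη => by
      obtain ⟨K, hK, hlt⟩ := Real.lt_sInf_add_pos hAne hη
      exact (h1 K hK).trans (mul_le_mul_of_nonneg_left hlt.le hρ0)
    have h3 : sInf A ≤ ρ * sInf A := le_of_forall_pos_le_add fun η hη =>
      (h2 η hη).trans (by nlinarith)
    nlinarith
  rw [Metric.tendsto_nhds]
  intro η hη
  obtain ⟨K, hK, hlt⟩ := Real.lt_sInf_add_pos hAne hη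
  filter_upwards [hK.2] with u hu
  rw [Real.dist_eq, sub_zero, abs_div, abs_of_pos (hw0 u)]
  exact lt_of_le_of_lt hu (by linarith)

end Renewal

/-- Asymptotics of the solution of a defective renewal equation whose kernel `L` has a tail
proportional to that of the long-tailed distribution `F`. -/
theorem tendsto_of_renewal_equation_of_longTailed {F L : Measure ℝ} [IsProbabilityMeasure F]
    [IsFiniteMeasure L]
    (hF : F (Set.Iio 0) = 0) (hL : L (Set.Iio 0) = 0) {a ρ : ℝ} (hρ : L.real Set.univ = ρ)
    (hρ1 : ρ < 1) (hpos : ∀ u, 0 < tail F u)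
    (hlong : ∀ M, 0 ≤ M → Tendsto (fun u => tail F (u - M) / tail F u) atTop (𝓝 1))
    (hLF : Tendsto (fun u => tail L u / tail F u) atTop (𝓝 a))
    (hconv : Tendsto (fun u => (∫ x, tail F (u - x) ∂L) / tail F u) atTop (𝓝 (a + ρ)))
    {ψ : ℝ → ℝ} (hψ : Measurable ψ) (hψ0 : ∀ u, 0 ≤ ψ u) (hψ1 : ∀ u, ψ u ≤ 1)
    (hneg : ∀ u, u < 0 → ψ u = 1) (heq : ∀ u, 0 ≤ u → ψ u = ∫ x, ψ (u - x) ∂L) :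
    Tendsto (fun u => ψ u / tail F u) atTop (𝓝 (a / (1 - ρ))) := by
  set c := a / (1 - ρ) with hc
  have hρ' : 0 < 1 - ρ := by linarith
  have hca : c * (1 - ρ) = a := div_mul_cancel₀ _ hρ'.ne'
  set w := tail F
  have hwm : Measurable w := measurable_tail F
  have hw1 : ∀ u, w u ≤ 1 := tail_le_one F
  have hwneg : ∀ u, u < 0 → w u = 1 := fun u hu => by
    rw [show w u = _ from tail_of_neg hF hu]; simp
  have hwi : ∀ u, Integrable (fun x => w (u - x)) L := fun u =>
    integrable_of_bounded (C := 1) (by fun_prop)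
      (fun x => by rw [abs_of_pos (hpos _)]; exact hw1 _)
  have hψi : ∀ u, Integrable (fun x => ψ (u - x)) L := fun u =>
    integrable_of_bounded (C := 1) (by fun_prop)
      (fun x => by rw [abs_of_nonneg (hψ0 _)]; exact hψ1 _)
  -- both `ψ` and `w` equal `1` on the negative half-line
  have hsplit : ∀ f : ℝ → ℝ, (∀ u, u < 0 → f u = 1) → ∀ u, Integrable (fun x => f (u - x)) L →
      ∫ x, f (u - x) ∂L = ∫ x in Set.Iic u, f (u - x) ∂L + tail L u := by
    intro f hf u hi
    rw [← integral_add_compl measurableSet_Iic hi, Set.compl_Iic]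
    congr 1
    rw [setIntegral_congr_fun measurableSet_Ioi (g := fun _ => (1 : ℝ))
      (fun x hx => hf _ (by have : u < x := hx; linarith))]
    simp [tail]
  have hlast : ∀ M, 0 ≤ M →
      Tendsto (fun u => L.real (Set.Ioc (u - M) u) / w u) atTop (𝓝 0) := by
    intro M hM
    have h1 : Tendsto (fun u => tail L (u - M) / w (u - M)) atTop (𝓝 a) :=
      hLF.comp (tendsto_atTop_add_const_right _ (-M) tendsto_id)
    have h2 := (h1.mul (hlong M hM)).sub hLF
    rw [mul_one, sub_self] at h2
    refine h2.congr fun u => ?_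
    have h3 : L.real (Set.Ioc (u - M) u) = tail L (u - M) - tail L u := by
      rw [tail, tail, ← measureReal_sdiff (Set.Ioi_subset_Ioi (by linarith)) measurableSet_Ioi,
        Set.Ioi_sdiff_Ioi]
    rw [h3, sub_div, div_mul_div_cancel₀ (hpos _).ne']
  have hJ : Tendsto (fun u => (∫ x in Set.Iic u, w (u - x) ∂L) / w u) atTop (𝓝 ρ) := by
    have h1 := hconv.sub hLF
    rw [add_sub_cancel_left] at h1
    refine h1.congr fun u => ?_
    rw [hsplit w hwneg u (hwi u), ← sub_div, add_sub_cancel_right]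
  set e : ℝ → ℝ := fun u => (1 - c) * tail L u + c * (∫ x, w (u - x) ∂L) - c * w u with he_def
  have he : Tendsto (fun u => |e u| / w u) atTop (𝓝 0) := by
    have h1 := ((hLF.const_mul (1 - c)).add (hconv.const_mul c)).sub_const c
    have h2 : (1 - c) * a + c * (a + ρ) - c = 0 := by linear_combination -hca
    rw [h2] at h1
    have h3 := h1.abs
    rw [abs_zero] at h3
    refine h3.congr fun u => ?_
    rw [← abs_of_pos (hpos u), ← abs_div, abs_of_pos (hpos u), he_def]
    congr 1
    field_simp [(hpos u).ne']
  have hmain := tendsto_zero_of_renewal_inequality (L := L) (w := w) (e := fun u => |e u|)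
    (D := fun u => ψ u - c * w u) (ρ := ρ) (C := 1 + |c|) hL (tail_antitone F) hpos hw1
    (by fun_prop)
    (fun u => by
      refine (abs_sub _ _).trans (add_le_add ?_ ?_)
      · rw [abs_of_nonneg (hψ0 u)]; exact hψ1 u
      · rw [abs_mul, abs_of_pos (hpos u)]
        exact mul_le_of_le_one_right (abs_nonneg _) (hw1 u))
    (by rw [← hρ]; exact measureReal_nonneg) hρ1
    (fun u hu => by
      have h1 : ψ u - c * w u = e u + ∫ x in Set.Iic u, (ψ (u - x) - c * w (u - x)) ∂L := by
        rw [integral_sub (hψi u).integrableOn ((hwi u).const_mul c).integrableOn,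
          integral_const_mul]
        have h2 := hsplit ψ hneg u (hψi u)
        have h3 := hsplit w hwneg u (hwi u)
        have h4 := heq u hu
        simp only [he_def]
        rw [h4, h2, h3]; ring
      rw [h1]
      exact (abs_add_le _ _).trans (add_le_add le_rfl (abs_integral_le_integral_abs)))
    he hJ hlast
  have h := hmain.add_const c
  rw [zero_add] at h
  refine h.congr fun u => ?_
  rw [sub_div, mul_div_cancel_right₀ _ (hpos u).ne', sub_add_cancel]

/-! ### Subexponential distributions -/

lemma tail_conv (F H : Measure ℝ) [IsFiniteMeasure F] [IsFiniteMeasure H] (u : ℝ) :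
    tail (F.conv H) u = ∫ x, tail F (u - x) ∂H := by
  have h : (F.conv H) (Set.Ioi u) = ∫⁻ x, F (Set.Ioi (u - x)) ∂H := by
    rw [Measure.conv_comm, ← lintegral_indicator_one measurableSet_Ioi,
      Measure.lintegral_conv (by fun_prop (disch := exact measurableSet_Ioi))]
    refine lintegral_congr fun x => ?_
    rw [← lintegral_indicator_one measurableSet_Ioi]
    refine lintegral_congr fun y => ?_
    simp only [Set.indicator, Set.mem_Ioi, sub_lt_iff_lt_add', Pi.one_apply]
  rw [tail, measureReal_def, h]
  exact (integral_toReal (by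
    have : Antitone fun v : ℝ => F (Set.Ioi v) := fun _ _ h => measure_mono (Set.Ioi_subset_Ioi h)
    exact (this.measurable.comp (measurable_const.sub measurable_id)).aemeasurable)
    (Eventually.of_forall fun x => measure_lt_top _ _)).symm

lemma tendsto_tail_atTop (F : Measure ℝ) [IsProbabilityMeasure F] :
    Tendsto (tail F) atTop (𝓝 0) := by
  have h := (tendsto_cdf_atTop F).const_sub 1
  rw [sub_self] at h
  refine h.congr fun u => ?_
  rw [cdf_eq_real, tail, ← Set.compl_Iic, probReal_compl_eq_one_sub measurableSet_Iic]

namespace IsSubexponential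

variable {F : Measure ℝ}

lemma tail_pos (hF : IsSubexponential F) (u : ℝ) : 0 < tail F u := by
  have := hF.isNonnegDistribution.isProbabilityMeasure
  refine lt_of_le_of_ne (tail_nonneg F u) fun h0 => ?_
  have h1 := hF.tendsto 1 le_rfl
  have h2 : (fun u : ℝ => tail (convPow F 1) u / tail F u) =ᶠ[atTop] fun _ => 0 := by
    filter_upwards [eventually_ge_atTop u] with v hv
    rw [le_antisymm (h0 ▸ tail_antitone F hv) (tail_nonneg F v), div_zero]
  simpa using tendsto_nhds_unique (h1.congr' h2) tendsto_const_nhds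

lemma tendsto_convolution (hF : IsSubexponential F) :
    Tendsto (fun u => (∫ x, tail F (u - x) ∂F) / tail F u) atTop (𝓝 2) := by
  have := hF.isNonnegDistribution.isProbabilityMeasure
  have h := hF.tendsto 2 (by norm_num)
  simp only [convPow, Measure.dirac_zero_conv, tail_conv] at h
  simpa using h

/-- Subexponential distributions are long-tailed: of the mass `2` in the limit of
`tail (F * F) / tail F`, the summands at most `M` and above `u` account for all but
`tail F M`, which bounds the contribution of the summands in between. -/
lemma tendsto_tail_sub (hF : IsSubexponential F) (M : ℝ) (hM : 0 ≤ M) :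
    Tendsto (fun u => tail F (u - M) / tail F u) atTop (𝓝 1) := by
  have := hF.isNonnegDistribution.isProbabilityMeasure
  have hF0 := hF.isNonnegDistribution.nonneg
  have hpos := hF.tail_pos
  have hwm := measurable_tail F
  have hup : Tendsto (fun u => ((∫ x, tail F (u - x) ∂F) / tail F u - 2 + tail F M) /
      (tail F M - tail F u)) atTop (𝓝 1) := by
    have h := ((hF.tendsto_convolution.sub_const 2).add_const (tail F M)).div
      ((tendsto_tail_atTop F).const_sub (tail F M)) (by rw [sub_zero]; exact (hpos M).ne')
    rwa [sub_self, zero_add, sub_zero, div_self (hpos M).ne'] at h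
  refine tendsto_of_tendsto_of_tendsto_of_le_of_le' tendsto_const_nhds hup ?_ ?_
  · refine Eventually.of_forall fun u => ?_
    rw [one_le_div (hpos u)]
    exact tail_antitone F (by linarith)
  · filter_upwards [eventually_ge_atTop M,
      (tendsto_tail_atTop F).eventually (gt_mem_nhds (hpos M))] with u hu hlt
    have hi : ∀ s, IntegrableOn (fun x => tail F (u - x)) s F := fun s =>
      integrable_of_bounded (C := 1) (by fun_prop)
        (fun x => by rw [abs_of_pos (hpos _)]; exact tail_le_one F _)
    have hsplit : ∫ x, tail F (u - x) ∂F = ∫ x in Set.Iic M, tail F (u - x) ∂F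
        + ∫ x in Set.Ioc M u, tail F (u - x) ∂F + ∫ x in Set.Ioi u, tail F (u - x) ∂F := by
      rw [← setIntegral_union (Set.Iic_disjoint_Ioc le_rfl) measurableSet_Ioc (hi _) (hi _),
        Set.Iic_union_Ioc_eq_Iic hu, ← Set.compl_Iic, integral_add_compl measurableSet_Iic]
      exact integrableOn_univ.1 (hi _)
    have i1 : (1 - tail F M) * tail F u ≤ ∫ x in Set.Iic M, tail F (u - x) ∂F := by
      calc (1 - tail F M) * tail F u = ∫ x in Set.Iic M, tail F u ∂F := by
            rw [setIntegral_const, tail, ← Set.compl_Iic, probReal_compl_eq_one_sub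
              measurableSet_Iic, smul_eq_mul, sub_sub_cancel]
        _ ≤ _ := by
            refine integral_mono_ae (integrable_const _) (hi _) ?_
            filter_upwards [ae_restrict_of_ae (ae_nonneg_of_measure_Iio hF0)] with x hx
            exact tail_antitone F (by linarith)
    have i2 : (tail F M - tail F u) * tail F (u - M)
        ≤ ∫ x in Set.Ioc M u, tail F (u - x) ∂F := by
      calc (tail F M - tail F u) * tail F (u - M) = ∫ x in Set.Ioc M u, tail F (u - M) ∂F := by
            rw [setIntegral_const, smul_eq_mul, tail, tail,
              ← measureReal_sdiff (Set.Ioi_subset_Ioi hu) measurableSet_Ioi, Set.Ioi_sdiff_Ioi]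
        _ ≤ _ := by
            refine setIntegral_mono_on (integrable_const _) (hi _) measurableSet_Ioc fun x hx => ?_
            exact tail_antitone F (by linarith [hx.1])
    have i3 : ∫ x in Set.Ioi u, tail F (u - x) ∂F = tail F u := by
      rw [setIntegral_congr_fun measurableSet_Ioi (g := fun _ => (1 : ℝ)) fun x hx => ?_]
      · simp [tail]
      · have hx' : u < x := hx
        change tail F (u - x) = 1
        rw [tail_of_neg hF0 (by linarith)]; simp
    rw [le_div_iff₀ (by linarith), div_mul_eq_mul_div, div_le_iff₀ (hpos u)]
    have : ((∫ x, tail F (u - x) ∂F) / tail F u - 2 + tail F M) * tail F u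
        = (∫ x, tail F (u - x) ∂F) - 2 * tail F u + tail F M * tail F u := by
      field_simp [(hpos u).ne']
    rw [this, hsplit, i3]
    linarith

/-- Long-tailed distributions decay more slowly than every exponential. -/
lemma exists_tail_sub_le (hF : IsSubexponential F) {η : ℝ} (hη : 0 < η) :
    ∃ C, ∀ u x, 0 ≤ u → 0 ≤ x → tail F (u - x) ≤ C * Real.exp (η * x) * tail F u := by
  have := hF.isNonnegDistribution.isProbabilityMeasure
  have hpos := hF.tail_pos
  have hev := (hF.tendsto_tail_sub 1 zero_le_one).eventually
    (gt_mem_nhds (Real.one_lt_exp_iff.2 hη))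
  obtain ⟨u₁, hu₁⟩ := eventually_atTop.1 hev
  set u₀ := max u₁ 1
  set A := 1 / tail F u₀
  have hA1 : 1 ≤ A := (one_le_div (hpos _)).2 (tail_le_one F _)
  have hstep : ∀ u, u₀ ≤ u → tail F (u - 1) ≤ Real.exp η * tail F u := fun u hu =>
    ((div_lt_iff₀ (hpos u)).1 (hu₁ u ((le_max_left _ _).trans hu))).le
  have hE : 1 ≤ Real.exp η := Real.one_le_exp hη.le
  have key : ∀ n : ℕ, ∀ u x, 0 ≤ u → u ≤ u₀ + n → 0 ≤ x →
      tail F (u - x) ≤ A * Real.exp η * Real.exp (η * x) * tail F u := by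
    intro n
    induction n with
    | zero =>
      intro u x _ hu hx
      have h1 : 1 ≤ A * tail F u := by
        rw [one_div_mul_eq_div, one_le_div (hpos _)]
        exact tail_antitone F (by simpa using hu)
      have h2 : 1 ≤ Real.exp η * Real.exp (η * x) :=
        one_le_mul_of_one_le_of_one_le hE (Real.one_le_exp (by positivity))
      calc tail F (u - x) ≤ 1 := tail_le_one F _
        _ ≤ (A * tail F u) * (Real.exp η * Real.exp (η * x)) :=
          one_le_mul_of_one_le_of_one_le h1 h2
        _ = _ := by ring
    | succ n ih =>
      intro u x hu hun hx
      rcases le_total u (u₀ + n) with h | h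
      · exact ih u x hu h hx
      have hu0 : u₀ ≤ u := le_trans (by simp) h
      have hu1 : 1 ≤ u := (le_max_right _ _).trans hu0
      rcases le_total x 1 with hx1 | hx1
      · calc tail F (u - x) ≤ tail F (u - 1) := tail_antitone F (by linarith)
          _ ≤ Real.exp η * tail F u := hstep u hu0
          _ ≤ (A * Real.exp (η * x)) * (Real.exp η * tail F u) :=
            le_mul_of_one_le_left (mul_nonneg (by positivity) (hpos u).le)
              (one_le_mul_of_one_le_of_one_le hA1 (Real.one_le_exp (by positivity)))
          _ = _ := by ring
      · have h3 := ih (u - 1) (x - 1) (by linarith) (by push_cast at hun; linarith) (by linarith)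
        rw [sub_sub_sub_cancel_right] at h3
        refine h3.trans ?_
        have hA0 : 0 ≤ A := by linarith
        calc A * Real.exp η * Real.exp (η * (x - 1)) * tail F (u - 1)
            ≤ A * Real.exp η * Real.exp (η * (x - 1)) * (Real.exp η * tail F u) :=
              mul_le_mul_of_nonneg_left (hstep u hu0) (by positivity)
          _ = A * Real.exp η * (Real.exp (η * (x - 1)) * Real.exp η) * tail F u := by ring
          _ = _ := by rw [← Real.exp_add]; ring_nf
  refine ⟨A * Real.exp η, fun u x hu hx => ?_⟩
  obtain ⟨n, hn⟩ := exists_nat_ge (u - u₀)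
  exact key n u x hu (by linarith) hx

variable {κ : Measure ℝ} {β : ℝ}

/-- A light-tailed measure contributes only its total mass to the convolution with `F`. -/
lemma tendsto_integral_light (hF : IsSubexponential F) (hκ : κ (Set.Iio 0) = 0) (hβ : 0 < β)
    (hint : Integrable (fun x => Real.exp (β * x)) κ) :
    Tendsto (fun u => (∫ x, tail F (u - x) ∂κ) / tail F u) atTop (𝓝 (κ.real Set.univ)) := by
  have := hF.isNonnegDistribution.isProbabilityMeasure
  have hpos := hF.tail_pos
  have hwm := measurable_tail F
  obtain ⟨C, hC⟩ := hF.exists_tail_sub_le hβ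
  have h := tendsto_integral_filter_of_dominated_convergence (μ := κ) (l := atTop)
    (F := fun u x => tail F (u - x) / tail F u) (f := fun _ => 1)
    (fun x => C * Real.exp (β * x))
    (Eventually.of_forall fun u => by
      exact (by fun_prop : Measurable fun x => tail F (u - x) / tail F u).aestronglyMeasurable)
    (by
      filter_upwards [eventually_ge_atTop 0] with u hu
      filter_upwards [ae_nonneg_of_measure_Iio hκ] with x hx
      rw [Real.norm_of_nonneg (div_nonneg (hpos _).le (hpos _).le), div_le_iff₀ (hpos u)]
      exact hC u x hu hx)
    (hint.const_mul C)
    (by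
      filter_upwards [ae_nonneg_of_measure_Iio hκ] with x hx
      exact hF.tendsto_tail_sub x hx)
  simp only [integral_const, smul_eq_mul, mul_one, integral_div] at h
  exact h

lemma tendsto_tail_light (hF : IsSubexponential F) (hκ : κ (Set.Iio 0) = 0) (hβ : 0 < β)
    (hint : Integrable (fun x => Real.exp (β * x)) κ) :
    Tendsto (fun u => tail κ u / tail F u) atTop (𝓝 0) := by
  have := hF.isNonnegDistribution.isProbabilityMeasure
  have hF0 := hF.isNonnegDistribution.nonneg
  have hpos := hF.tail_pos
  obtain ⟨C, hC⟩ := hF.exists_tail_sub_le hβ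
  have h := tendsto_integral_filter_of_dominated_convergence (μ := κ) (l := atTop)
    (F := fun u x => (Set.Ioi u).indicator (fun _ => 1 / tail F u) x) (f := fun _ => 0)
    (fun x => C * Real.exp (β * x))
    (Eventually.of_forall fun u =>
      (measurable_const.indicator measurableSet_Ioi).aestronglyMeasurable)
    (by
      filter_upwards [eventually_ge_atTop 0] with u hu
      filter_upwards [ae_nonneg_of_measure_Iio hκ] with x hx
      have h0 := hC u x hu hx
      by_cases hxu : x ∈ Set.Ioi u
      · have hxu' : u < x := hxu
        rw [tail_of_neg hF0 (by linarith), probReal_univ] at h0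
        rw [Set.indicator_of_mem hxu, Real.norm_of_nonneg (by have := hpos u; positivity),
          div_le_iff₀ (hpos u)]
        exact h0
      · rw [Set.indicator_of_notMem hxu, norm_zero]
        have h1 := (hpos (u - x)).le.trans h0
        exact nonneg_of_mul_nonneg_left h1 (hpos u))
    (hint.const_mul C)
    (by
      refine Eventually.of_forall fun x => ?_
      refine tendsto_const_nhds.congr' ?_
      filter_upwards [eventually_ge_atTop x] with u hu
      rw [Set.indicator_of_notMem (by simpa using hu)])
  rw [integral_zero] at h
  refine h.congr fun u => ?_
  rw [integral_indicator measurableSet_Ioi, setIntegral_const, smul_eq_mul, mul_one_div, ← tail]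

/-- The renewal equation with a kernel that is the sum of a light-tailed measure and a multiple
of a subexponential distribution. -/
theorem tendsto_of_renewal_equation [IsFiniteMeasure κ] (hF : IsSubexponential F)
    (hκ : κ (Set.Iio 0) = 0)
    (hβ : 0 < β) (hint : Integrable (fun x => Real.exp (β * x)) κ) {a : ℝ} (ha : 0 ≤ a)
    {ψ : ℝ → ℝ} (hρ : κ.real Set.univ + a < 1)
    (hψ : Measurable ψ) (hψ0 : ∀ u, 0 ≤ ψ u) (hψ1 : ∀ u, ψ u ≤ 1)
    (hneg : ∀ u, u < 0 → ψ u = 1)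
    (heq : ∀ u, 0 ≤ u → ψ u = ∫ x, ψ (u - x) ∂(κ + ENNReal.ofReal a • F)) :
    Tendsto (fun u => ψ u / tail F u) atTop (𝓝 (a / (1 - (κ.real Set.univ + a)))) := by
  have := hF.isNonnegDistribution.isProbabilityMeasure
  have hF0 := hF.isNonnegDistribution.nonneg
  have hpos := hF.tail_pos
  have hwm := measurable_tail F
  have hfin : IsFiniteMeasure (ENNReal.ofReal a • F) := F.smul_finite ENNReal.ofReal_ne_top
  have hreal : ∀ s, (κ + ENNReal.ofReal a • F).real s = κ.real s + a * F.real s := fun s => by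
    rw [measureReal_add_apply, measureReal_ennreal_smul_apply, ENNReal.toReal_ofReal ha]
  refine tendsto_of_renewal_equation_of_longTailed (L := κ + ENNReal.ofReal a • F) hF0
    (by simp [hκ, hF0]) (by rw [hreal]; simp) hρ hpos hF.tendsto_tail_sub ?_ ?_ hψ hψ0 hψ1 hneg heq
  · have h := (hF.tendsto_tail_light hκ hβ hint).add_const a
    rw [zero_add] at h
    refine h.congr fun u => ?_
    rw [show tail (κ + ENNReal.ofReal a • F) u = tail κ u + a * tail F u from hreal _, add_div,
      mul_div_cancel_right₀ _ (hpos u).ne']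
  · have h := (hF.tendsto_integral_light hκ hβ hint).add (hF.tendsto_convolution.const_mul a)
    have h2 : κ.real Set.univ + a * 2 = a + (κ.real Set.univ + a) := by ring
    rw [h2] at h
    refine h.congr fun u => ?_
    have hi : ∀ (μ : Measure ℝ) [IsFiniteMeasure μ], Integrable (fun x => tail F (u - x)) μ :=
      fun μ _ => integrable_of_bounded (C := 1) (by fun_prop)
        (fun x => by rw [abs_of_pos (hpos _)]; exact tail_le_one F _)
    rw [integral_add_measure (hi _) (hi _), integral_smul_measure, ENNReal.toReal_ofReal ha,
      smul_eq_mul, add_div, mul_div_assoc]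

end IsSubexponential

/-! ### Exponential decay of phase-type tails -/

section Subintensity

variable {m : ℕ} {T : Matrix (Fin m) (Fin m) ℝ}

lemma exists_shift_nonneg (hT : ∀ i j, i ≠ j → 0 ≤ T i j) :
    ∃ c : ℝ, 0 ≤ c ∧ ∀ i j, 0 ≤ (T + c • (1 : Matrix (Fin m) (Fin m) ℝ)) i j := by
  refine ⟨∑ i, |T i i|, Finset.sum_nonneg fun i _ => abs_nonneg _, fun i j => ?_⟩
  rcases eq_or_ne i j with rfl | h
  · have h1 := Finset.single_le_sum (f := fun i => |T i i|) (fun i _ => abs_nonneg _)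
      (Finset.mem_univ i)
    have h2 := neg_abs_le (T i i)
    simp only [Matrix.add_apply, Matrix.smul_apply, Matrix.one_apply_eq, smul_eq_mul, mul_one]
    linarith
  · simpa [Matrix.one_apply_ne h] using hT i j h

open scoped Matrix.Norms.Operator in
lemma hasSum_exp_mulVec (A : Matrix (Fin m) (Fin m) ℝ) (v : Fin m → ℝ) (i : Fin m) :
    HasSum (fun n : ℕ => (n.factorial : ℝ)⁻¹ * (A ^ n *ᵥ v) i)
      ((NormedSpace.exp A *ᵥ v) i) := by
  have h := NormedSpace.exp_series_hasSum_exp' (𝕂 := ℝ) A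
  have hc : Continuous fun M : Matrix (Fin m) (Fin m) ℝ => (M *ᵥ v) i := by
    fun_prop
  have h2 := h.map (AddMonoidHom.mk' (fun M : Matrix (Fin m) (Fin m) ℝ => (M *ᵥ v) i)
    (fun M N => by simp [Matrix.add_mulVec])) hc
  simp only [Function.comp_def, AddMonoidHom.mk'_apply, Matrix.smul_mulVec, Pi.smul_apply,
    smul_eq_mul] at h2
  exact h2

/-- Shifting `T` by `c` multiplies the exponential by a positive scalar, so that signs and bounds
can be read off from the power series of an entrywise nonnegative matrix. -/
lemma exp_smul_mulVec_shift (c x : ℝ) (v : Fin m → ℝ) :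
    NormedSpace.exp (x • T) *ᵥ v = Real.exp (-(x * c)) •
      (NormedSpace.exp (x • (T + c • (1 : Matrix (Fin m) (Fin m) ℝ))) *ᵥ v) := by
  have h1 : x • T = algebraMap ℝ (Matrix (Fin m) (Fin m) ℝ) (-(x * c))
      + x • (T + c • (1 : Matrix (Fin m) (Fin m) ℝ)) := by
    rw [Algebra.algebraMap_eq_smul_one, smul_add, smul_smul, neg_smul]
    abel
  have h2 : NormedSpace.exp (algebraMap ℝ (Matrix (Fin m) (Fin m) ℝ) (-(x * c)))
      = algebraMap ℝ (Matrix (Fin m) (Fin m) ℝ) (Real.exp (-(x * c))) := by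
    rw [Real.exp_eq_exp_ℝ]
    open scoped Matrix.Norms.Operator in exact (NormedSpace.algebraMap_exp_comm _).symm
  rw [h1, Matrix.exp_add_of_commute _ _ (Algebra.commute_algebraMap_left _ _), h2,
    Algebra.algebraMap_eq_smul_one, smul_mul_assoc, one_mul, Matrix.smul_mulVec]

lemma exp_add_smul_mulVec (x y : ℝ) (v : Fin m → ℝ) :
    NormedSpace.exp ((x + y) • T) *ᵥ v
      = NormedSpace.exp (x • T) *ᵥ (NormedSpace.exp (y • T) *ᵥ v) := by
  rw [add_smul, Matrix.exp_add_of_commute _ _ (((Commute.refl T).smul_left x).smul_right y),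
    Matrix.mulVec_mulVec]

lemma mulVec_mono {A : Matrix (Fin m) (Fin m) ℝ} (hA : ∀ i j, 0 ≤ A i j) {v w : Fin m → ℝ}
    (h : v ≤ w) : A *ᵥ v ≤ A *ᵥ w := fun i => by
  simp only [Matrix.mulVec, dotProduct]
  exact Finset.sum_le_sum fun j _ => mul_le_mul_of_nonneg_left (h j) (hA i j)

lemma exp_smul_mulVec_nonneg (hT : ∀ i j, i ≠ j → 0 ≤ T i j) {x : ℝ} (hx : 0 ≤ x)
    {v : Fin m → ℝ} (hv : 0 ≤ v) : 0 ≤ NormedSpace.exp (x • T) *ᵥ v := by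
  obtain ⟨c, -, hc⟩ := exists_shift_nonneg hT
  set B := x • (T + c • (1 : Matrix (Fin m) (Fin m) ℝ))
  have hB : ∀ i j, 0 ≤ B i j := fun i j => mul_nonneg hx (hc i j)
  have hpow : ∀ n : ℕ, 0 ≤ B ^ n *ᵥ v := by
    intro n
    induction n with
    | zero => simpa using hv
    | succ n ih =>
      rw [pow_succ', ← Matrix.mulVec_mulVec]
      simpa using mulVec_mono hB ih
  rw [exp_smul_mulVec_shift c]
  refine smul_nonneg (Real.exp_pos _).le fun i => ?_
  exact (hasSum_exp_mulVec B v i).nonneg fun n => mul_nonneg (by positivity) (hpow n i)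

lemma exp_smul_mulVec_mono (hT : ∀ i j, i ≠ j → 0 ≤ T i j) {x : ℝ} (hx : 0 ≤ x)
    {v w : Fin m → ℝ} (h : v ≤ w) :
    NormedSpace.exp (x • T) *ᵥ v ≤ NormedSpace.exp (x • T) *ᵥ w := by
  have := exp_smul_mulVec_nonneg hT hx (sub_nonneg.2 h)
  rwa [Matrix.mulVec_sub, sub_nonneg] at this

lemma exp_smul_mulVec_one_le (hT : ∀ i j, i ≠ j → 0 ≤ T i j) (hrow : ∀ i, ∑ j, T i j ≤ 0)
    {x : ℝ} (hx : 0 ≤ x) : NormedSpace.exp (x • T) *ᵥ (1 : Fin m → ℝ) ≤ 1 := by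
  obtain ⟨c, hc0, hc⟩ := exists_shift_nonneg hT
  set B := x • (T + c • (1 : Matrix (Fin m) (Fin m) ℝ))
  have hB : ∀ i j, 0 ≤ B i j := fun i j => mul_nonneg hx (hc i j)
  have hB1 : B *ᵥ (1 : Fin m → ℝ) ≤ (x * c) • (1 : Fin m → ℝ) := by
    rw [Matrix.smul_mulVec, mul_smul]
    refine smul_le_smul_of_nonneg_left ?_ hx
    rw [Matrix.add_mulVec, Matrix.smul_mulVec, Matrix.one_mulVec]
    intro i
    have : (T *ᵥ (1 : Fin m → ℝ)) i = ∑ j, T i j := by simp [Matrix.mulVec, dotProduct]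
    simp only [Pi.add_apply, Pi.smul_apply, this]
    linarith [hrow i]
  have hpow : ∀ n : ℕ, B ^ n *ᵥ (1 : Fin m → ℝ) ≤ (x * c) ^ n • (1 : Fin m → ℝ) := by
    intro n
    induction n with
    | zero => simp
    | succ n ih =>
      rw [pow_succ', ← Matrix.mulVec_mulVec]
      refine (mulVec_mono hB ih).trans ?_
      rw [Matrix.mulVec_smul, pow_succ, mul_smul]
      exact smul_le_smul_of_nonneg_left hB1 (by positivity)
  rw [exp_smul_mulVec_shift c]
  intro i
  have h1 : HasSum (fun n : ℕ => (n.factorial : ℝ)⁻¹ * (x * c) ^ n) (Real.exp (x * c)) := by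
    have := NormedSpace.exp_series_hasSum_exp' (𝕂 := ℝ) (x * c)
    rw [← Real.exp_eq_exp_ℝ] at this
    simpa using this
  have h2 : (NormedSpace.exp B *ᵥ (1 : Fin m → ℝ)) i ≤ Real.exp (x * c) := by
    refine hasSum_le (fun n => ?_) (hasSum_exp_mulVec B 1 i) h1
    refine mul_le_mul_of_nonneg_left ?_ (by positivity)
    simpa using hpow n i
  calc Real.exp (-(x * c)) * (NormedSpace.exp B *ᵥ (1 : Fin m → ℝ)) i
      ≤ Real.exp (-(x * c)) * Real.exp (x * c) :=
        mul_le_mul_of_nonneg_left h2 (Real.exp_pos _).le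
    _ = 1 := by rw [← Real.exp_add]; simp

lemma exp_smul_mulVec_one_antitone (hT : ∀ i j, i ≠ j → 0 ≤ T i j) (hrow : ∀ i, ∑ j, T i j ≤ 0)
    {x y : ℝ} (hx : 0 ≤ x) (hxy : x ≤ y) :
    NormedSpace.exp (y • T) *ᵥ (1 : Fin m → ℝ) ≤ NormedSpace.exp (x • T) *ᵥ (1 : Fin m → ℝ) := by
  have h : y = x + (y - x) := by ring
  rw [h, exp_add_smul_mulVec]
  exact exp_smul_mulVec_mono hT hx (exp_smul_mulVec_one_le hT hrow (sub_nonneg.2 hxy))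

open scoped Matrix.Norms.Operator in
lemma hasDerivAt_exp_smul_mulVec (v : Fin m → ℝ) :
    HasDerivAt (fun x : ℝ => NormedSpace.exp (x • T) *ᵥ v) (T *ᵥ v) 0 := by
  have h := hasDerivAt_exp_smul_const T (0 : ℝ)
  rw [zero_smul, NormedSpace.exp_zero, one_mul] at h
  rw [hasDerivAt_pi]
  intro i
  have hL := (LinearMap.toContinuousLinearMap
    ({ toFun := fun M => (M *ᵥ v) i
       map_add' := fun M N => by simp [Matrix.add_mulVec]
       map_smul' := fun c M => by simp [Matrix.smul_mulVec] } :
      Matrix (Fin m) (Fin m) ℝ →ₗ[ℝ] ℝ)).hasFDerivAt.comp_hasDerivAt (0 : ℝ) h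
  exact hL

/-- A nonsingular subintensity matrix drives the Markov chain to absorption: the survival vector
`exp (x T) 1` decreases to a vector `v` that is fixed by every `exp (y T)`, so that `T v = 0`. -/
lemma tendsto_exp_smul_mulVec_one (hT : ∀ i j, i ≠ j → 0 ≤ T i j) (hrow : ∀ i, ∑ j, T i j ≤ 0)
    (hdet : T.det ≠ 0) :
    Tendsto (fun x : ℝ => NormedSpace.exp ((max x 0) • T) *ᵥ (1 : Fin m → ℝ)) atTop (𝓝 0) := by
  set f : ℝ → Fin m → ℝ := fun x => NormedSpace.exp ((max x 0) • T) *ᵥ (1 : Fin m → ℝ) with hf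
  have hanti : Antitone f := fun x y h =>
    exp_smul_mulVec_one_antitone hT hrow (le_max_right _ _) (max_le_max_right 0 h)
  have hf0 : ∀ x, 0 ≤ f x := fun x =>
    exp_smul_mulVec_nonneg hT (le_max_right _ _) zero_le_one
  have hlim : Tendsto f atTop (𝓝 fun i => ⨅ x, f x i) := by
    rw [tendsto_pi_nhds]
    intro i
    refine tendsto_atTop_ciInf (fun x y h => hanti h i) ⟨0, ?_⟩
    rintro _ ⟨x, rfl⟩
    exact hf0 x i
  set v : Fin m → ℝ := fun i => ⨅ x, f x i
  have hfix : ∀ y : ℝ, 0 ≤ y → NormedSpace.exp (y • T) *ᵥ v = v := by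
    intro y hy
    have hcont : Continuous fun w : Fin m → ℝ => NormedSpace.exp (y • T) *ᵥ w := by fun_prop
    have h1 := (hcont.tendsto v).comp hlim
    have h2 := hlim.comp (tendsto_atTop_add_const_left _ y tendsto_id)
    refine tendsto_nhds_unique (h1.congr' ?_) h2
    filter_upwards [eventually_ge_atTop 0] with x hx
    simp only [Function.comp, hf, id, max_eq_left hx, max_eq_left (add_nonneg hy hx)]
    rw [exp_add_smul_mulVec]
  have hTv : T *ᵥ v = 0 := by
    have h1 := (hasDerivAt_exp_smul_mulVec (T := T) v).hasDerivWithinAt (s := Set.Ici 0)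
    have h2 : HasDerivWithinAt (fun x : ℝ => NormedSpace.exp (x • T) *ᵥ v) 0 (Set.Ici 0) 0 :=
      (hasDerivWithinAt_const (0 : ℝ) (Set.Ici 0) v).congr (fun y hy => hfix y hy)
        (hfix 0 le_rfl)
    exact (uniqueDiffWithinAt_Ici 0).eq_deriv _ h1 h2
  rwa [Matrix.eq_zero_of_mulVec_eq_zero hdet hTv] at hlim

end Subintensity

/-- Phase-type tails decay exponentially: once all entries of the survival vector `exp (x₀ T) 1` are
at most `1 / 2`, the semigroup property halves it over every time span of length `x₀`. -/
theorem IsPhaseType.exists_tail_le {F : Measure ℝ} (hF : IsPhaseType F) :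
    ∃ β > 0, ∀ x, 0 ≤ x → tail F x ≤ 2 * Real.exp (-(β * x)) := by
  obtain ⟨-, m, α, T, hα, hα1, hT, hrow, hdet, htail⟩ := hF
  have hlim := tendsto_exp_smul_mulVec_one hT hrow hdet
  have hev : ∀ᶠ x : ℝ in atTop, ∀ i,
      (NormedSpace.exp ((max x 0) • T) *ᵥ (1 : Fin m → ℝ)) i < 1 / 2 := by
    rw [eventually_all]
    intro i
    exact ((tendsto_pi_nhds.1 hlim) i).eventually (gt_mem_nhds (by norm_num))
  obtain ⟨x₀, hx₀, hx₀pos⟩ := (hev.and (eventually_gt_atTop 0)).exists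
  rw [max_eq_left hx₀pos.le] at hx₀
  have hgeom : ∀ n : ℕ, NormedSpace.exp ((n * x₀) • T) *ᵥ (1 : Fin m → ℝ)
      ≤ ((1 / 2 : ℝ) ^ n) • (1 : Fin m → ℝ) := by
    intro n
    induction n with
    | zero => simp
    | succ n ih =>
      have h1 : ((n + 1 : ℕ) : ℝ) * x₀ = n * x₀ + x₀ := by push_cast; ring
      have h2 : NormedSpace.exp (x₀ • T) *ᵥ (1 : Fin m → ℝ) ≤ (1 / 2 : ℝ) • (1 : Fin m → ℝ) :=
        fun i => by simpa using (hx₀ i).le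
      rw [h1, exp_add_smul_mulVec]
      refine (exp_smul_mulVec_mono hT (mul_nonneg n.cast_nonneg hx₀pos.le) h2).trans ?_
      rw [Matrix.mulVec_smul, pow_succ', mul_smul (1 / 2 : ℝ)]
      exact smul_le_smul_of_nonneg_left ih (by norm_num : (0 : ℝ) ≤ 1 / 2)
  refine ⟨Real.log 2 / x₀, div_pos (Real.log_pos one_lt_two) hx₀pos, fun x hx => ?_⟩
  set n := ⌊x / x₀⌋₊
  have hn : n * x₀ ≤ x := (le_div_iff₀ hx₀pos).1 (Nat.floor_le (by positivity))
  have hn' : x / x₀ < n + 1 := Nat.lt_floor_add_one _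
  have hpow : (1 / 2 : ℝ) ^ n ≤ 2 * Real.exp (-(Real.log 2 / x₀ * x)) := by
    have h1 : (1 / 2 : ℝ) ^ n = Real.exp (-(Real.log 2 * n)) := by
      rw [mul_comm, Real.exp_neg, Real.exp_nat_mul, Real.exp_log two_pos, one_div, inv_pow]
    have h2 : 2 * Real.exp (-(Real.log 2 / x₀ * x))
        = Real.exp (Real.log 2 + -(Real.log 2 / x₀ * x)) := by
      rw [Real.exp_add, Real.exp_log two_pos]
    rw [h1, h2, Real.exp_le_exp]
    have h3 := mul_le_mul_of_nonneg_left hn'.le (Real.log_pos one_lt_two).le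
    have h4 : Real.log 2 / x₀ * x = Real.log 2 * (x / x₀) := by ring
    rw [h4]; linarith
  rw [htail x hx]
  calc α ⬝ᵥ (NormedSpace.exp (x • T) *ᵥ fun _ => 1)
      ≤ ∑ i, α i * (2 * Real.exp (-(Real.log 2 / x₀ * x))) := by
        refine Finset.sum_le_sum fun i _ => mul_le_mul_of_nonneg_left ?_ (hα i)
        have h1 := exp_smul_mulVec_one_antitone hT hrow (by positivity) hn i
        have h2 := hgeom n i
        simp only [Pi.smul_apply, Pi.one_apply, smul_eq_mul, mul_one] at h2
        exact h1.trans (h2.trans hpow)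
    _ ≤ _ := by
        rw [← Finset.sum_mul]
        exact mul_le_of_le_one_left (by positivity) hα1

/-! ### Product measures on sequences -/

/-- Prepending an independent coordinate to an i.i.d. sequence gives an i.i.d. sequence. -/
lemma map_natCases_infinitePi (μ : Measure ℝ) [IsProbabilityMeasure μ] :
    (μ.prod (Measure.infinitePi fun _ : ℕ => μ)).map
      (fun p : ℝ × (ℕ → ℝ) => fun n : ℕ => n.casesOn p.1 p.2)
      = Measure.infinitePi fun _ : ℕ => μ := by
  have hmeas : Measurable (fun p : ℝ × (ℕ → ℝ) => (fun n : ℕ => n.casesOn p.1 p.2 : ℕ → ℝ)) := by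
    refine measurable_pi_lambda _ fun n => ?_
    cases n with
    | zero => exact measurable_fst
    | succ n => exact (measurable_pi_apply n).comp measurable_snd
  refine Measure.eq_infinitePi _ fun s t ht => ?_
  classical
  obtain ⟨N, hN⟩ : ∃ N, s ⊆ Finset.range (N + 1) := by
    obtain ⟨N, hN⟩ := s.exists_nat_subset_range
    exact ⟨N, hN.trans (Finset.range_mono (Nat.le_succ N))⟩
  -- enlarge the index set of the box to an initial segment
  set t' : ℕ → Set ℝ := fun i => if i ∈ s then t i else Set.univ with ht'
  have ht'm : ∀ i, MeasurableSet (t' i) := fun i => by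
    simp only [ht']; split_ifs
    exacts [ht i, MeasurableSet.univ]
  have hpi : (s : Set ℕ).pi t = (Finset.range (N + 1) : Set ℕ).pi t' := by
    ext x
    simp only [Set.mem_pi, Finset.mem_coe, ht']
    refine ⟨fun h i _ => ?_, fun h i hi => ?_⟩
    · split_ifs with hi
      exacts [h i hi, trivial]
    · simpa [hi] using h i (hN hi)
  have hprod : ∏ i ∈ s, μ (t i) = ∏ i ∈ Finset.range (N + 1), μ (t' i) := by
    rw [← Finset.prod_subset hN fun i _ hi => by simp [ht', hi]]
    exact Finset.prod_congr rfl fun i hi => by simp [ht', hi]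
  rw [hpi, hprod, Measure.map_apply hmeas (MeasurableSet.pi (Finset.countable_toSet _)
    fun i _ => ht'm i), Finset.prod_range_succ', mul_comm]
  have hpre : (fun p : ℝ × (ℕ → ℝ) => (fun n : ℕ => n.casesOn p.1 p.2 : ℕ → ℝ)) ⁻¹'
      (Finset.range (N + 1) : Set ℕ).pi t'
      = t' 0 ×ˢ (Finset.range N : Set ℕ).pi fun i => t' (i + 1) := by
    ext p
    simp only [Set.mem_preimage, Set.mem_pi, Finset.coe_range, Set.mem_Iio, Set.mem_prod]
    refine ⟨fun h => ⟨h 0 (Nat.succ_pos N), fun i hi => h (i + 1) (by omega)⟩, fun h i hi => ?_⟩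
    cases i with
    | zero => exact h.1
    | succ i => exact h.2 i (by omega)
  rw [hpre, Measure.prod_prod, Measure.infinitePi_pi _ fun i _ => ht'm _]

/-- Coordinatewise differences of two independent i.i.d. sequences form an i.i.d. sequence. -/
lemma map_sub_infinitePi (μ ν : Measure ℝ) [IsProbabilityMeasure μ] [IsProbabilityMeasure ν] :
    ((Measure.infinitePi fun _ : ℕ => μ).prod (Measure.infinitePi fun _ : ℕ => ν)).map
      (fun p => fun n : ℕ => p.2 n - p.1 n)
      = Measure.infinitePi fun _ : ℕ => (ν.prod μ).map fun q => q.1 - q.2 := by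
  have : IsProbabilityMeasure ((ν.prod μ).map fun q : ℝ × ℝ => q.1 - q.2) :=
    Measure.isProbabilityMeasure_map (by fun_prop)
  refine Measure.eq_infinitePi _ fun s t ht => ?_
  have hsm : MeasurableSet ((s : Set ℕ).pi t) :=
    MeasurableSet.pi (Finset.countable_toSet _) fun i _ => ht i
  rw [Measure.map_apply (by fun_prop) hsm, Measure.prod_apply_symm
    ((by fun_prop : Measurable fun p : (ℕ → ℝ) × (ℕ → ℝ) => fun n : ℕ => p.2 n - p.1 n) hsm)]
  set h : ℕ → ℝ → ℝ≥0∞ := fun i x => μ {y | x - y ∈ t i} with hh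
  have hhm : ∀ i, Measurable (h i) := fun i =>
    measurable_measure_prodMk_left (s := {q : ℝ × ℝ | q.1 - q.2 ∈ t i})
      ((by fun_prop : Measurable fun q : ℝ × ℝ => q.1 - q.2) (ht i))
  have hfib : ∀ x : ℕ → ℝ, (Measure.infinitePi fun _ : ℕ => μ) ((fun y => (y, x)) ⁻¹'
      ((fun p : (ℕ → ℝ) × (ℕ → ℝ) => fun n : ℕ => p.2 n - p.1 n) ⁻¹' (s : Set ℕ).pi t))
      = ∏ i ∈ s, h i (x i) := by
    intro x
    have : (fun y => (y, x)) ⁻¹' ((fun p : (ℕ → ℝ) × (ℕ → ℝ) => fun n : ℕ => p.2 n - p.1 n) ⁻¹'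
        (s : Set ℕ).pi t) = (s : Set ℕ).pi fun i => {y | x i - y ∈ t i} := by
      ext y; simp [Set.mem_pi]
    have hm : ∀ i ∈ s, MeasurableSet {y : ℝ | x i - y ∈ t i} := fun i _ =>
      (by fun_prop : Measurable fun y : ℝ => x i - y) (ht i)
    rw [this, Measure.infinitePi_pi _ hm]
  simp_rw [hfib]
  rw [lintegral_prod_eq_prod_lintegral_of_indepFun s (fun i (x : ℕ → ℝ) => h i (x i))
    (iIndepFun_infinitePi hhm) fun i => (hhm i).comp (measurable_pi_apply i)]
  refine Finset.prod_congr rfl fun i _ => ?_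
  have hev := (measurePreserving_eval_infinitePi (fun _ : ℕ => ν) i).lintegral_comp (hhm i)
  simp only [Function.eval] at hev
  rw [hev, Measure.map_apply (by fun_prop) (ht i),
    Measure.prod_apply ((by fun_prop : Measurable fun q : ℝ × ℝ => q.1 - q.2) (ht i))]
  rfl

/-! ### The exponential distribution -/

lemma integral_expMeasure {r : ℝ} (hr : 0 < r) (f : ℝ → ℝ) :
    ∫ t, f t ∂(expMeasure r) = ∫ t in Set.Ioi 0, r * Real.exp (-(r * t)) * f t := by
  have hm : Measurable (exponentialPDF r) := (measurable_exponentialPDFReal r).ennreal_ofReal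
  rw [expMeasure, gammaMeasure, show gammaPDF 1 r = exponentialPDF r from rfl,
    integral_withDensity_eq_integral_toReal_smul hm
      (Eventually.of_forall fun x => ENNReal.ofReal_lt_top), ← integral_Ici_eq_integral_Ioi,
      ← integral_indicator measurableSet_Ici]
  refine integral_congr_ae (Eventually.of_forall fun t => ?_)
  simp only [exponentialPDF_eq, Set.indicator, Set.mem_Ici, smul_eq_mul]
  split_ifs with h
  · rw [ENNReal.toReal_ofReal (by positivity)]
  · simp

lemma expMeasure_Iic_zero {r : ℝ} : expMeasure r (Set.Iic 0) = 0 := by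
  rw [expMeasure, gammaMeasure, show gammaPDF 1 r = exponentialPDF r from rfl,
    withDensity_apply _ measurableSet_Iic, ← restrict_Iio_eq_restrict_Iic]
  exact lintegral_exponentialPDF_of_nonpos le_rfl

lemma integral_id_expMeasure {r : ℝ} (hr : 0 < r) : ∫ t, t ∂(expMeasure r) = 1 / r := by
  rw [integral_expMeasure hr]
  have h := Real.integral_rpow_mul_exp_neg_mul_Ioi (a := 2) (r := r) two_pos hr
  have h2 : ∀ t : ℝ, r * Real.exp (-(r * t)) * t
      = r * (t ^ ((2 : ℝ) - 1) * Real.exp (-(r * t))) := fun t => by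
    rw [show (2 : ℝ) - 1 = 1 by norm_num, Real.rpow_one]; ring
  simp_rw [h2, integral_const_mul, h, Real.Gamma_two]
  rw [Real.rpow_two]
  field_simp

lemma integrable_id_expMeasure {r : ℝ} (hr : 0 < r) : Integrable (fun t => t) (expMeasure r) := by
  by_contra h
  have h1 := integral_id_expMeasure hr
  rw [integral_undef h] at h1
  have := one_div_pos.2 hr
  linarith

/-! ### The random walk of net claims -/

/-- The sequences of increments whose partial sums never exceed `u`. -/
def stayBelow (u : ℝ) : Set (ℕ → ℝ) := {y | ∀ n, ∑ i ∈ Finset.range n, y i ≤ u}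

lemma measurableSet_stayBelow (u : ℝ) : MeasurableSet (stayBelow u) := by
  have : stayBelow u = ⋂ n, {y : ℕ → ℝ | ∑ i ∈ Finset.range n, y i ≤ u} := by
    ext; simp [stayBelow]
  rw [this]
  exact MeasurableSet.iInter fun n => measurableSet_le (by fun_prop) measurable_const

lemma stayBelow_mono : Monotone stayBelow := fun _ _ h _ hy n => (hy n).trans h

lemma stayBelow_of_neg {u : ℝ} (hu : u < 0) : stayBelow u = ∅ := by
  ext y
  simp only [Set.mem_empty_iff_false, iff_false]
  intro h
  have := h 0
  simp at this
  linarith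

/-- Probability that the random walk with step distribution `μ` never exceeds `u`, computed on the
canonical space of increments. The walk starts at `0`, so this vanishes for `u < 0`. -/
noncomputable def survival (μ : Measure ℝ) (u : ℝ) : ℝ :=
  (Measure.infinitePi fun _ : ℕ => μ).real (stayBelow u)

section Survival

variable (μ : Measure ℝ)

lemma survival_nonneg (u : ℝ) : 0 ≤ survival μ u := measureReal_nonneg

lemma survival_of_neg {u : ℝ} (hu : u < 0) : survival μ u = 0 := by
  simp [survival, stayBelow_of_neg hu]

variable [IsProbabilityMeasure μ]

lemma survival_le_one (u : ℝ) : survival μ u ≤ 1 := measureReal_le_one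

lemma survival_mono : Monotone (survival μ) := fun _ _ h => measureReal_mono (stayBelow_mono h)

lemma measurable_survival : Measurable (survival μ) := (survival_mono μ).measurable

/-- First-step decomposition of the survival probability. -/
lemma survival_eq_integral {u : ℝ} (hu : 0 ≤ u) :
    survival μ u = ∫ y, survival μ (u - y) ∂μ := by
  set Q := Measure.infinitePi fun _ : ℕ => μ
  have hmeas : Measurable (fun p : ℝ × (ℕ → ℝ) => (fun n : ℕ => n.casesOn p.1 p.2 : ℕ → ℝ)) := by
    refine measurable_pi_lambda _ fun n => ?_
    cases n with
    | zero => exact measurable_fst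
    | succ n => exact (measurable_pi_apply n).comp measurable_snd
  have h1 : Q (stayBelow u) = ∫⁻ y, Q (stayBelow (u - y)) ∂μ := by
    conv_lhs => rw [show Q = _ from (map_natCases_infinitePi μ).symm]
    rw [Measure.map_apply hmeas (measurableSet_stayBelow u),
      Measure.prod_apply (hmeas (measurableSet_stayBelow u))]
    refine lintegral_congr fun y => ?_
    congr 1
    ext z
    simp only [stayBelow, Set.mem_preimage, Set.mem_ofPred_eq]
    refine ⟨fun h n => ?_, fun h n => ?_⟩
    · have := h (n + 1)
      rw [Finset.sum_range_succ'] at this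
      change ∑ i ∈ Finset.range n, z i + y ≤ u at this
      linarith
    · cases n with
      | zero => simpa using hu
      | succ n =>
        rw [Finset.sum_range_succ']
        have := h n
        change ∑ i ∈ Finset.range n, z i + y ≤ u
        linarith
  rw [survival, measureReal_def, h1]
  refine (integral_toReal ?_ (Eventually.of_forall fun x => measure_lt_top _ _)).symm
  have : Monotone fun v : ℝ => Q (stayBelow v) := fun _ _ h => measure_mono (stayBelow_mono h)
  exact (this.measurable.comp (measurable_const.sub measurable_id)).aemeasurable

/-- A random walk with negative drift stays below high levels, by the strong law of large
numbers. -/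
lemma tendsto_survival_atTop (hint : Integrable (fun y => y) μ) (hdrift : ∫ y, y ∂μ < 0) :
    Tendsto (survival μ) atTop (𝓝 1) := by
  set Q := Measure.infinitePi fun _ : ℕ => μ
  have hmp : ∀ i : ℕ, MeasurePreserving (fun y : ℕ → ℝ => y i) Q μ := fun i =>
    measurePreserving_eval_infinitePi (fun _ : ℕ => μ) i
  have hind : iIndepFun (fun (i : ℕ) (y : ℕ → ℝ) => y i) Q :=
    iIndepFun_infinitePi (X := fun _ => id) fun _ => measurable_id
  have hslln := strong_law_ae_real (μ := Q) (fun (i : ℕ) (y : ℕ → ℝ) => y i)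
    ((hmp 0).integrable_comp_of_integrable hint) (fun i j h => hind.indepFun h)
    (fun i => ⟨(hmp i).measurable.aemeasurable, (hmp 0).measurable.aemeasurable, by
      rw [(hmp i).map_eq, (hmp 0).map_eq]⟩)
  have hmean : ∫ y, y 0 ∂Q = ∫ y, y ∂μ := by
    rw [← (hmp 0).map_eq]
    exact (integral_map (hmp 0).measurable.aemeasurable measurable_id.aestronglyMeasurable).symm
  have hall : Q (⋃ u : ℝ, stayBelow u) = 1 := by
    have hae : ∀ᵐ y ∂Q, y ∈ ⋃ u : ℝ, stayBelow u := by
      filter_upwards [hslln] with y hy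
      rw [hmean] at hy
      have hbdd : IsBoundedUnder (· ≤ ·) atTop fun n : ℕ => ∑ i ∈ Finset.range n, y i := by
        refine ⟨0, eventually_map.2 ?_⟩
        filter_upwards [hy.eventually (gt_mem_nhds hdrift), eventually_gt_atTop 0] with n hn hn0
        have hn0' : (0 : ℝ) < n := by exact_mod_cast hn0
        exact (neg_of_div_neg_left hn hn0'.le).le
      obtain ⟨u, hu⟩ := hbdd.bddAbove_range
      exact Set.mem_iUnion.2 ⟨u, fun n => hu ⟨n, rfl⟩⟩
    exact (measure_congr (eventuallyEq_univ.2 hae)).trans measure_univ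
  have h := tendsto_measure_iUnion_atTop (μ := Q) stayBelow_mono
  rw [hall] at h
  exact (ENNReal.tendsto_toReal ENNReal.one_ne_top).comp h

end Survival

section Lundberg

variable (G : Measure ℝ) [IsProbabilityMeasure G]

/-- Law of the net loss of the insurer between two successive claims: a claim with law `G` minus
an independent exponential waiting time with rate `lam`. -/
noncomputable def netClaim (lam : ℝ) (G : Measure ℝ) : Measure ℝ :=
  (G.prod (expMeasure lam)).map fun q => q.1 - q.2

/-- The measure on `(0, ∞)` with density `lam * tail G`. It has total mass `lam * mean G` and, when
this is less than `1`, it is the defective distribution of the first strict ascending ladder height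
of the random walk with steps of law `netClaim lam G`. -/
noncomputable def ladderKernel (lam : ℝ) (G : Measure ℝ) : Measure ℝ :=
  (volume.restrict (Set.Ioi 0)).withDensity fun t => ENNReal.ofReal (lam * tail G t)

variable {G} {lam : ℝ}

lemma isProbabilityMeasure_netClaim (hlam : 0 < lam) : IsProbabilityMeasure (netClaim lam G) := by
  have := isProbabilityMeasure_expMeasure hlam
  exact Measure.isProbabilityMeasure_map (by fun_prop)

lemma integrable_id_netClaim (hlam : 0 < lam) (hG : Integrable (fun x => x) G) :
    Integrable (fun x => x) (netClaim lam G) := by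
  have := isProbabilityMeasure_expMeasure hlam
  rw [netClaim]
  refine (integrable_map_measure measurable_id.aestronglyMeasurable (by fun_prop)).2 ?_
  exact (hG.comp_fst _).sub ((integrable_id_expMeasure hlam).comp_snd _)

lemma integral_id_netClaim (hlam : 0 < lam) (hG : Integrable (fun x => x) G) :
    ∫ y, y ∂(netClaim lam G) = mean G - 1 / lam := by
  have := isProbabilityMeasure_expMeasure hlam
  rw [netClaim]
  refine (integral_map (by fun_prop) measurable_id.aestronglyMeasurable).trans ?_
  simp only [id]
  rw [integral_sub (hG.comp_fst _) ((integrable_id_expMeasure hlam).comp_snd _),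
    integral_fun_fst (fun x => x), integral_fun_snd (fun x => x), integral_id_expMeasure hlam, mean]
  simp

lemma integral_ladderKernel (hlam : 0 < lam) (f : ℝ → ℝ) :
    ∫ x, f x ∂(ladderKernel lam G) = ∫ x in Set.Ioi 0, lam * tail G x * f x := by
  have := measurable_tail G
  rw [ladderKernel, integral_withDensity_eq_integral_toReal_smul (by fun_prop)
    (Eventually.of_forall fun x => ENNReal.ofReal_lt_top)]
  simp_rw [ENNReal.toReal_ofReal (mul_nonneg hlam.le (tail_nonneg G _)), smul_eq_mul]

lemma lintegral_tail (hG0 : G (Set.Iio 0) = 0) (hG : Integrable (fun x => x) G) :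
    ∫⁻ x in Set.Ioi 0, ENNReal.ofReal (tail G x) = ENNReal.ofReal (mean G) := by
  have hnn : 0 ≤ᵐ[G] fun x : ℝ => x := ae_nonneg_of_measure_Iio hG0
  rw [mean, ofReal_integral_eq_lintegral_ofReal hG hnn,
    lintegral_eq_lintegral_meas_lt G hnn hG.aemeasurable]
  exact lintegral_congr fun x => ofReal_measureReal

/-- First-step decomposition with the waiting time and the claim integrated separately. -/
lemma survival_netClaim_eq (hlam : 0 < lam) {u : ℝ} (hu : 0 ≤ u) :
    survival (netClaim lam G) u = ∫ t in Set.Ioi 0, lam * Real.exp (-(lam * t)) *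
      ∫ x, survival (netClaim lam G) (u + t - x) ∂G := by
  have := isProbabilityMeasure_expMeasure hlam
  have := isProbabilityMeasure_netClaim (G := G) hlam
  have hm := measurable_survival (netClaim lam G)
  have h0 := survival_nonneg (netClaim lam G)
  have h1 := survival_le_one (netClaim lam G)
  rw [survival_eq_integral _ hu]
  generalize survival (netClaim lam G) = φ at hm h0 h1 ⊢
  have hm' : Measurable fun y => φ (u - y) := by fun_prop
  rw [netClaim, integral_map (by fun_prop) hm'.aestronglyMeasurable,
    integral_prod_symm, integral_expMeasure hlam]
  · simp only [sub_sub_eq_add_sub, add_comm u, add_sub_assoc]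
  · exact Integrable.of_bound (hm.comp (by fun_prop)).aestronglyMeasurable 1
      (Eventually.of_forall fun q => by
        rw [Real.norm_of_nonneg (h0 _)]; exact h1 _)

end Lundberg

/-! ### From the first-step equation to the renewal equation -/

/-- A function that is an exponentially weighted average of the values of a monotone function `g`
to the right satisfies the integrated form of the differential equation `φ' = r (φ - g)`. -/
lemma sub_eq_intervalIntegral_of_exp_average {r : ℝ} (hr : 0 < r) {φ g : ℝ → ℝ} (hg : Monotone g)
    {C : ℝ} (hC : ∀ v, |g v| ≤ C)
    (hφ : ∀ u, 0 ≤ u → φ u = ∫ t in Set.Ioi 0, r * Real.exp (-(r * t)) * g (u + t))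
    {u : ℝ} (hu : 0 ≤ u) :
    φ u - φ 0 = ∫ v in (0 : ℝ)..u, r * (φ v - g v) := by
  set h : ℝ → ℝ := fun v => r * Real.exp (-(r * v)) * g v with hh
  have hgm := hg.measurable
  have hmeas : Measurable h := by fun_prop
  have hint : IntegrableOn h (Set.Ioi 0) := by
    have h1 : IntegrableOn (fun v : ℝ => r * Real.exp (-(r * v)) * C) (Set.Ioi 0) := by
      have := (integrableOn_exp_mul_Ioi (a := -r) (by linarith) 0)
      simp only [neg_mul] at this
      exact (this.const_mul r).mul_const C
    refine h1.mono' hmeas.aestronglyMeasurable (Eventually.of_forall fun v => ?_)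
    rw [hh, norm_mul, Real.norm_of_nonneg (by positivity)]
    exact mul_le_mul_of_nonneg_left (hC v) (by positivity)
  have hii : ∀ a b, IntervalIntegrable h volume a b := fun a b =>
    (hg.intervalIntegrable (a := a) (b := b)).continuousOn_mul (by fun_prop)
  set Φ : ℝ → ℝ := fun u => Real.exp (r * u) * ((∫ v in Set.Ioi 0, h v) - ∫ v in (0 : ℝ)..u, h v)
    with hΦ
  have hΦφ : ∀ u, 0 ≤ u → φ u = Φ u := by
    intro u hu
    have h1 : (∫ v in Set.Ioi 0, h v) - ∫ v in (0 : ℝ)..u, h v = ∫ v in Set.Ioi u, h v := by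
      rw [← intervalIntegral.integral_interval_add_Ioi hint
        (hint.mono_set (Set.Ioi_subset_Ioi hu)), add_sub_cancel_left]
    rw [hφ u hu, hΦ]
    simp only [h1]
    rw [← integral_indicator measurableSet_Ioi, ← integral_indicator measurableSet_Ioi,
      ← integral_const_mul, ← integral_sub_right_eq_self _ u]
    refine integral_congr_ae (Eventually.of_forall fun v => ?_)
    simp only [Set.indicator, Set.mem_Ioi, sub_pos, hh]
    split_ifs
    · rw [show -(r * (v - u)) = r * u + -(r * v) by ring, Real.exp_add, add_sub_cancel]
      ring
    · simp
  have hcont : Continuous Φ :=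
    (by fun_prop : Continuous fun u => Real.exp (r * u)).mul
      (continuous_const.sub (intervalIntegral.continuous_primitive hii 0))
  have hderiv : ∀ v, ContinuousAt g v → HasDerivAt Φ (r * (Φ v - g v)) v := by
    intro v hv
    have h1 : HasDerivAt (fun u => ∫ v in (0 : ℝ)..u, h v) (h v) v :=
      intervalIntegral.integral_hasDerivAt_right (hii 0 v)
        hmeas.stronglyMeasurable.stronglyMeasurableAtFilter
        ((by fun_prop : Continuous fun v : ℝ => r * Real.exp (-(r * v))).continuousAt.mul hv)
    have h2 : HasDerivAt (fun u => Real.exp (r * u)) (Real.exp (r * v) * r) v := by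
      simpa using ((hasDerivAt_id v).const_mul r).exp
    have h3 := h2.mul (h1.const_sub (∫ v in Set.Ioi 0, h v))
    have h4 : Real.exp (r * v) * (r * Real.exp (-(r * v)) * g v) = r * g v := by
      rw [Real.exp_neg]; field_simp
    refine h3.congr_deriv ?_
    simp only [hΦ, hh, mul_sub, mul_neg, h4]
    ring
  rw [hΦφ u hu, hΦφ 0 le_rfl, ← integral_eq_of_hasDerivAt_off_countable_of_le Φ
    (fun v => r * (Φ v - g v)) hu hg.countable_not_continuousAt hcont.continuousOn
    (fun v hv => hderiv v (not_not.1 hv.2))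
    (((hcont.intervalIntegrable _ _).sub hg.intervalIntegrable).const_mul r)]
  refine intervalIntegral.integral_congr fun v hv => ?_
  rw [Set.uIcc_of_le hu] at hv
  simp only [hΦφ v hv.1]

/-- Fubini's theorem for the primitive of the convolution of `φ` and `G`. -/
lemma intervalIntegral_convolution {G : Measure ℝ} [IsProbabilityMeasure G]
    (hG0 : G (Set.Iio 0) = 0) {φ : ℝ → ℝ} (hφ : Measurable φ) (h0 : ∀ u, 0 ≤ φ u)
    (h1 : ∀ u, φ u ≤ 1) (hneg : ∀ u, u < 0 → φ u = 0) {u : ℝ} (hu : 0 ≤ u) :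
    ∫ v in (0 : ℝ)..u, ∫ x, φ (v - x) ∂G = ∫ s in (0 : ℝ)..u, φ s * G.real (Set.Iic (u - s)) := by
  rw [intervalIntegral.integral_of_le hu, intervalIntegral.integral_of_le hu,
    integral_integral_swap (f := fun v x => φ (v - x))
      (Integrable.of_bound (hφ.comp (by fun_prop)).aestronglyMeasurable 1
        (Eventually.of_forall fun q => by
          simp only [Function.uncurry]; rw [Real.norm_of_nonneg (h0 _)]; exact h1 _))]
  have hsub : ∀ s x : ℝ, (Set.Iic (u - s)).indicator (fun _ => φ s) x
      = {q : ℝ × ℝ | q.2 ≤ u - q.1}.indicator (fun q => φ q.1) (s, x) := fun s x => rfl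
  have hmS : MeasurableSet {q : ℝ × ℝ | q.2 ≤ u - q.1} :=
    measurableSet_le (by fun_prop) (by fun_prop)
  have hinner : ∀ᵐ x ∂G, ∫ v in Set.Ioc 0 u, φ (v - x)
      = ∫ s in Set.Ioc 0 u, (Set.Iic (u - s)).indicator (fun _ => φ s) x := by
    filter_upwards [ae_nonneg_of_measure_Iio hG0] with x hx
    rw [← integral_indicator measurableSet_Ioc, ← integral_indicator measurableSet_Ioc,
      ← integral_add_right_eq_self _ x]
    have hne : ∀ᵐ s : ℝ, s ≠ 0 := by simp [ae_iff]
    refine integral_congr_ae ?_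
    filter_upwards [hne] with s hs
    simp only [Set.indicator, Set.mem_Ioc, Set.mem_Iic, add_sub_cancel_right]
    rcases lt_or_gt_of_ne hs with hs | hs
    · rw [hneg s hs]; simp
    · by_cases hsx : x ≤ u - s
      · rw [if_pos ⟨by linarith, by linarith⟩, if_pos ⟨hs, by linarith⟩, if_pos hsx]
      · rw [if_neg (fun h => hsx (by linarith [h.2])), if_neg hsx, ite_self]
  rw [integral_congr_ae hinner, integral_integral_swap]
  · refine integral_congr_ae (Eventually.of_forall fun s => ?_)
    simp only
    rw [integral_indicator measurableSet_Iic, setIntegral_const, smul_eq_mul, mul_comm]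
  · refine Integrable.of_bound (C := 1) ?_ (Eventually.of_forall fun q => ?_)
    · have : Measurable fun q : ℝ × ℝ => {q : ℝ × ℝ | q.2 ≤ u - q.1}.indicator
          (fun q => φ q.1) (q.2, q.1) :=
        ((hφ.comp measurable_fst).indicator hmS).comp measurable_swap
      exact this.aestronglyMeasurable
    · simp only [Function.uncurry, Set.indicator]
      split_ifs
      · rw [Real.norm_of_nonneg (h0 _)]; exact h1 _
      · simp

section LundbergRenewal

variable {G : Measure ℝ} [IsProbabilityMeasure G] {lam : ℝ}

lemma ladderKernel_univ (hlam : 0 ≤ lam) (hG0 : G (Set.Iio 0) = 0)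
    (hG : Integrable (fun x => x) G) :
    ladderKernel lam G Set.univ = ENNReal.ofReal (lam * mean G) := by
  rw [ladderKernel, withDensity_apply _ MeasurableSet.univ, Measure.restrict_univ]
  simp_rw [ENNReal.ofReal_mul hlam]
  rw [lintegral_const_mul' _ _ ENNReal.ofReal_ne_top, lintegral_tail hG0 hG]

lemma survival_sub_survival_zero (hlam : 0 < lam) (hG0 : G (Set.Iio 0) = 0) {u : ℝ} (hu : 0 ≤ u) :
    survival (netClaim lam G) u - survival (netClaim lam G) 0
      = ∫ x, survival (netClaim lam G) (u - x) ∂(ladderKernel lam G) := by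
  have := isProbabilityMeasure_netClaim (G := G) hlam
  have hφ := fun (u : ℝ) (hu : 0 ≤ u) => survival_netClaim_eq (G := G) hlam hu
  have hmono := survival_mono (netClaim lam G)
  have hm := measurable_survival (netClaim lam G)
  have h0 := survival_nonneg (netClaim lam G)
  have h1 := survival_le_one (netClaim lam G)
  have hneg : ∀ u, u < 0 → survival (netClaim lam G) u = 0 := fun u => survival_of_neg _
  generalize survival (netClaim lam G) = φ at *
  have hi : ∀ v, Integrable (fun x => φ (v - x)) G := fun v =>
    integrable_of_bounded (C := 1) (hm.comp (by fun_prop))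
      fun x => by rw [abs_of_nonneg (h0 _)]; exact h1 _
  have hg : Monotone fun v => ∫ x, φ (v - x) ∂G := fun v w h =>
    integral_mono (hi v) (hi w) fun x => hmono (by linarith)
  have hgC : ∀ v, |∫ x, φ (v - x) ∂G| ≤ 1 := fun v => by
    rw [abs_of_nonneg (integral_nonneg fun x => h0 _)]
    calc ∫ x, φ (v - x) ∂G ≤ ∫ x, (1 : ℝ) ∂G :=
          integral_mono (hi v) (integrable_const _) fun x => h1 _
      _ = 1 := by simp
  rw [sub_eq_intervalIntegral_of_exp_average hlam hg hgC hφ hu,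
    intervalIntegral.integral_const_mul,
    intervalIntegral.integral_sub hmono.intervalIntegrable hg.intervalIntegrable,
    intervalIntegral_convolution hG0 hm h0 h1 hneg hu, ← intervalIntegral.integral_sub
      hmono.intervalIntegrable, integral_ladderKernel hlam]
  · have e1 : ∫ s in (0 : ℝ)..u, (φ s - φ s * G.real (Set.Iic (u - s)))
        = ∫ s in (0 : ℝ)..u, φ (u - (u - s)) * tail G (u - s) := by
      refine intervalIntegral.integral_congr fun s _ => ?_
      rw [tail, ← Set.compl_Iic, probReal_compl_eq_one_sub measurableSet_Iic, sub_sub_cancel]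
      ring
    rw [e1, intervalIntegral.integral_comp_sub_left (fun x => φ (u - x) * tail G x) u, sub_self,
      sub_zero, intervalIntegral.integral_of_le hu, ← integral_const_mul,
      ← integral_indicator measurableSet_Ioc, ← integral_indicator measurableSet_Ioi]
    refine integral_congr_ae (Eventually.of_forall fun x => ?_)
    simp only [Set.indicator, Set.mem_Ioc, Set.mem_Ioi]
    by_cases hx : 0 < x
    · by_cases hxu : x ≤ u
      · rw [if_pos ⟨hx, hxu⟩, if_pos hx]; ring
      · rw [if_neg (fun h => hxu h.2), if_pos hx, hneg _ (by linarith), mul_zero]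
    · rw [if_neg (fun h => hx h.1), if_neg hx]
  · rw [intervalIntegrable_iff_integrableOn_Ioc_of_le hu]
    have hd : Monotone fun v : ℝ => G.real (Set.Iic v) := fun _ _ h =>
      measureReal_mono (Set.Iic_subset_Iic.2 h)
    refine integrable_of_bounded (C := 1) (hm.mul (hd.measurable.comp (by fun_prop))) fun x => ?_
    rw [abs_of_nonneg (mul_nonneg (h0 _) measureReal_nonneg)]
    exact mul_le_one₀ (h1 _) measureReal_nonneg measureReal_le_one

/-- The ruin probability solves a defective renewal equation. The constant of integration is
determined by letting the initial capital tend to infinity. -/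
theorem one_sub_survival_eq_integral (hlam : 0 < lam) (hG0 : G (Set.Iio 0) = 0)
    (hG : Integrable (fun x => x) G) (hload : lam * mean G < 1) {u : ℝ} (hu : 0 ≤ u) :
    1 - survival (netClaim lam G) u
      = ∫ x, (1 - survival (netClaim lam G) (u - x)) ∂(ladderKernel lam G) := by
  have := isProbabilityMeasure_netClaim (G := G) hlam
  have : IsFiniteMeasure (ladderKernel lam G) :=
    ⟨by rw [ladderKernel_univ hlam.le hG0 hG]; exact ENNReal.ofReal_lt_top⟩
  have hm := measurable_survival (netClaim lam G)
  have h0 := survival_nonneg (netClaim lam G)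
  have h1 := survival_le_one (netClaim lam G)
  have hlim : Tendsto (survival (netClaim lam G)) atTop (𝓝 1) := by
    refine tendsto_survival_atTop _ (integrable_id_netClaim hlam hG) ?_
    rw [integral_id_netClaim hlam hG, sub_neg, lt_div_iff₀ hlam, mul_comm]
    exact hload
  have heq := fun (u : ℝ) (hu : 0 ≤ u) => survival_sub_survival_zero (G := G) hlam hG0 hu
  generalize survival (netClaim lam G) = φ at *
  have hi : ∀ v, Integrable (fun x => φ (v - x)) (ladderKernel lam G) := fun v =>
    integrable_of_bounded (C := 1) (hm.comp (by fun_prop))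
      fun x => by rw [abs_of_nonneg (h0 _)]; exact h1 _
  have hconst : 1 - φ 0 = (ladderKernel lam G).real Set.univ := by
    have l1 := hlim.sub_const (φ 0)
    have l2 : Tendsto (fun u => ∫ x, φ (u - x) ∂(ladderKernel lam G)) atTop
        (𝓝 (∫ x, (1 : ℝ) ∂(ladderKernel lam G))) := by
      refine tendsto_integral_filter_of_dominated_convergence (fun _ => 1)
        (Eventually.of_forall fun v => (hi v).aestronglyMeasurable)
        (Eventually.of_forall fun v => Eventually.of_forall fun x => ?_) (integrable_const _)
        (Eventually.of_forall fun x => ?_)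
      · rw [Real.norm_of_nonneg (h0 _)]; exact h1 _
      · exact hlim.comp (tendsto_atTop_add_const_right _ (-x) tendsto_id)
    have l3 := tendsto_nhds_unique (l1.congr' ?_) l2
    · simpa using l3
    · filter_upwards [eventually_ge_atTop 0] with v hv using heq v hv
  rw [integral_sub (integrable_const _) (hi u), ← heq u hu]
  simp only [integral_const, smul_eq_mul, mul_one, ← hconst]
  ring

end LundbergRenewal

/-! ### Ruin as an exceedance of the random walk -/

section CountingPath

variable {τ : ℕ → ℝ} {p : ℝ≥0 → ℕ}

lemma strictMono_arrival (hτ : ∀ n, 0 < τ n) :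
    StrictMono fun n => ∑ i ∈ Finset.range n, τ i :=
  strictMono_nat_of_lt_succ fun n => by
    rw [Finset.sum_range_succ]; linarith [hτ n]

/-- If infinitely many arrivals occur before `t`, then `p t` is the junk value `0` of `Set.ncard`,
and the inequality still holds because the empty sum is at most `t`. -/
lemma arrival_le_of_counting (hτ : ∀ n, 0 < τ n)
    (hp : ∀ t : ℝ≥0, p t = Set.ncard {n : ℕ | ∑ i ∈ Finset.range (n + 1), τ i ≤ (t : ℝ)})
    (t : ℝ≥0) : ∑ i ∈ Finset.range (p t), τ i ≤ t := by
  rcases hn : p t with _ | m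
  · simp
  by_contra! hlt
  have hsub : {n : ℕ | ∑ i ∈ Finset.range (n + 1), τ i ≤ (t : ℝ)} ⊆ Set.Iio m := fun k hk => by
    have : k + 1 < m + 1 := (strictMono_arrival hτ).lt_iff_lt.1 (lt_of_le_of_lt hk hlt)
    exact Set.mem_Iio.2 (by omega)
  have h1 := Set.ncard_le_ncard hsub (Set.finite_Iio m)
  rw [← hp t, hn, Set.ncard_Iio_nat] at h1
  omega

lemma counting_eq_of_mem_Ico (hτ : ∀ n, 0 < τ n)
    (hp : ∀ t : ℝ≥0, p t = Set.ncard {n : ℕ | ∑ i ∈ Finset.range (n + 1), τ i ≤ (t : ℝ)})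
    {n : ℕ} {t : ℝ≥0} (h1 : ∑ i ∈ Finset.range n, τ i ≤ t)
    (h2 : (t : ℝ) < ∑ i ∈ Finset.range (n + 1), τ i) : p t = n := by
  have hset : {k : ℕ | ∑ i ∈ Finset.range (k + 1), τ i ≤ (t : ℝ)} = Set.Iio n := by
    ext k
    refine ⟨fun hk => ?_, fun hk => ?_⟩
    · have : k + 1 < n + 1 := (strictMono_arrival hτ).lt_iff_lt.1 (lt_of_le_of_lt hk h2)
      exact Set.mem_Iio.2 (by omega)
    · exact ((strictMono_arrival hτ).monotone (Nat.succ_le_of_lt hk)).trans h1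
  rw [hp t, hset, Set.ncard_Iio_nat]

/-- The reserve can first become negative only at a claim epoch. -/
lemma exists_reserve_neg_iff (hτ : ∀ n, 0 < τ n)
    (hp : ∀ t : ℝ≥0, p t = Set.ncard {n : ℕ | ∑ i ∈ Finset.range (n + 1), τ i ≤ (t : ℝ)})
    (x : ℕ → ℝ) (u : ℝ) :
    (∃ t : ℝ≥0, u + (t : ℝ) - ∑ i ∈ Finset.range (p t), x i < 0) ↔
      (fun n => x n - τ n) ∉ stayBelow u := by
  simp only [stayBelow, Set.mem_ofPred_eq, not_forall, not_le, Finset.sum_sub_distrib]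
  constructor
  · rintro ⟨t, ht⟩
    exact ⟨p t, by linarith [arrival_le_of_counting hτ hp t]⟩
  · rintro ⟨n, hn⟩
    have h0 : 0 ≤ ∑ i ∈ Finset.range n, τ i := Finset.sum_nonneg fun i _ => (hτ i).le
    obtain ⟨t, ht⟩ : ∃ t : ℝ≥0, (t : ℝ) = ∑ i ∈ Finset.range n, τ i :=
      ⟨Real.toNNReal _, Real.coe_toNNReal _ h0⟩
    have hpn : p t = n := counting_eq_of_mem_Ico hτ hp ht.ge
      (ht ▸ strictMono_arrival hτ (Nat.lt_succ_self n))
    refine ⟨t, ?_⟩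
    rw [hpn, ht]
    linarith

/-- The infimum of the times at which the path `p` is at least `n`. Only rational times are used, so
that this is a measurable function of the path; for counting paths, which are right-continuous,
this does not change the infimum. -/
noncomputable def hittingTime (n : ℕ) (p : ℝ≥0 → ℕ) : ℝ≥0∞ :=
  ⨅ q : ℚ, if n ≤ p (Real.toNNReal q) then ENNReal.ofReal q else ∞

lemma measurable_hittingTime (n : ℕ) : Measurable (hittingTime n) := by
  refine Measurable.iInf fun q => Measurable.ite ?_ measurable_const measurable_const
  exact measurableSet_le measurable_const (measurable_pi_apply _)

/-- The `n`-th arrival epoch is recovered from the counting path. Rational times slightly after the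
epoch, and before the next one, show that the infimum is not larger; this does not require that
the arrival epochs tend to infinity. -/
lemma hittingTime_eq (hτ : ∀ n, 0 < τ n)
    (hp : ∀ t : ℝ≥0, p t = Set.ncard {n : ℕ | ∑ i ∈ Finset.range (n + 1), τ i ≤ (t : ℝ)})
    (n : ℕ) : hittingTime n p = ENNReal.ofReal (∑ i ∈ Finset.range n, τ i) := by
  have h0 : 0 ≤ ∑ i ∈ Finset.range n, τ i := Finset.sum_nonneg fun i _ => (hτ i).le
  refine le_antisymm ?_ ?_
  · refine le_of_forall_gt fun r hr => ?_
    obtain ⟨s, hs0, hs, hsr⟩ : ∃ s : ℝ, 0 ≤ s ∧ ∑ i ∈ Finset.range n, τ i < s ∧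
        ENNReal.ofReal s ≤ r := by
      rcases eq_or_ne r ∞ with rfl | hr'
      · exact ⟨∑ i ∈ Finset.range n, τ i + 1, by linarith, by linarith, le_top⟩
      · exact ⟨r.toReal, ENNReal.toReal_nonneg, (ENNReal.ofReal_lt_iff_lt_toReal h0 hr').1 hr,
          (ENNReal.ofReal_toReal hr').le⟩
    obtain ⟨q, hq1, hq2⟩ := exists_rat_btwn
      (lt_min hs (strictMono_arrival hτ (Nat.lt_succ_self n)))
    have hq0 : (0 : ℝ) ≤ q := h0.trans hq1.le
    have hpn : p (Real.toNNReal q) = n := counting_eq_of_mem_Ico hτ hp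
      (by rw [Real.coe_toNNReal _ hq0]; exact hq1.le)
      (by rw [Real.coe_toNNReal _ hq0]; exact hq2.trans_le (min_le_right _ _))
    refine lt_of_le_of_lt (iInf_le _ q) ?_
    rw [if_pos hpn.ge]
    refine lt_of_lt_of_le ?_ hsr
    exact (ENNReal.ofReal_lt_ofReal_iff (hq0.trans_lt (hq2.trans_le (min_le_left _ _)))).2
      (hq2.trans_le (min_le_left _ _))
  · refine le_iInf fun q => ?_
    split_ifs with h
    · have h1 := ((strictMono_arrival hτ).monotone h).trans (arrival_le_of_counting hτ hp _)
      simp only [Real.coe_toNNReal'] at h1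
      rcases le_max_iff.1 h1 with h1 | h1
      · exact ENNReal.ofReal_le_ofReal h1
      · simp [ENNReal.ofReal_of_nonpos h1]
    · exact le_top

end CountingPath

section Model

variable {Ω : Type*} [MeasurableSpace Ω] {P : Measure Ω}
  {N : ℝ≥0 → Ω → ℕ} {X : ℕ → Ω → ℝ} {lam : ℝ} {G : Measure ℝ}

lemma ae_pos_of_hasLaw_expMeasure {τ : ℕ → Ω → ℝ} (hτ : ∀ n, HasLaw (τ n) (expMeasure lam) P) :
    ∀ᵐ ω ∂P, ∀ n, 0 < τ n ω := by
  rw [ae_all_iff]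
  intro n
  have h : ∀ᵐ x ∂(P.map (τ n)), 0 < x := by
    rw [(hτ n).map_eq, ae_iff]
    simp only [not_lt]
    exact expMeasure_Iic_zero (r := lam)
  exact ae_of_ae_map (hτ n).aemeasurable h

/-- The interarrival times are almost surely a measurable function of the counting process, and
therefore independent of the claim sizes. -/
lemma indepFun_interarrival {τ : ℕ → Ω → ℝ} (hpos : ∀ᵐ ω ∂P, ∀ n, 0 < τ n ω)
    (hN : ∀ᵐ ω ∂P, ∀ t : ℝ≥0,
      N t ω = Set.ncard {n : ℕ | ∑ i ∈ Finset.range (n + 1), τ i ω ≤ (t : ℝ)})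
    (hind : IndepFun (fun ω t => N t ω) (fun ω i => X i ω) P) :
    IndepFun (fun ω n => τ n ω) (fun ω i => X i ω) P := by
  set g : (ℝ≥0 → ℕ) → ℕ → ℝ := fun p n =>
    (hittingTime (n + 1) p).toReal - (hittingTime n p).toReal
  have hg : Measurable g := measurable_pi_lambda _ fun n =>
    (measurable_hittingTime (n + 1)).ennreal_toReal.sub (measurable_hittingTime n).ennreal_toReal
  refine (hind.comp hg measurable_id).congr ?_ EventuallyEq.rfl
  filter_upwards [hpos, hN] with ω h1 h2
  funext n
  have h3 := fun n => hittingTime_eq (τ := fun n => τ n ω) (p := fun t => N t ω) h1 h2 n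
  simp only [Function.comp, g, h3]
  rw [ENNReal.toReal_ofReal (Finset.sum_nonneg fun i _ => (h1 i).le),
    ENNReal.toReal_ofReal (Finset.sum_nonneg fun i _ => (h1 i).le), Finset.sum_range_succ,
    add_sub_cancel_left]

theorem IsCramerLundberg.ruinProbability_eq [IsProbabilityMeasure P] [IsProbabilityMeasure G]
    (hlam : 0 < lam) (h : IsCramerLundberg N X lam G P) (u : ℝ) :
    ruinProbability P N X u = 1 - survival (netClaim lam G) u := by
  have := isProbabilityMeasure_expMeasure hlam
  have := isProbabilityMeasure_netClaim (G := G) hlam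
  obtain ⟨τ, hτ, hτi, hN⟩ := h.poisson
  have hpos := ae_pos_of_hasLaw_expMeasure hτ
  have hind := indepFun_interarrival hpos hN h.indep
  have hτm : AEMeasurable (fun ω n => τ n ω) P := aemeasurable_pi_iff.2 fun n => (hτ n).aemeasurable
  have hXm : AEMeasurable (fun ω n => X n ω) P :=
    aemeasurable_pi_iff.2 fun n => (h.hasLaw n).aemeasurable
  have hYm : AEMeasurable (fun ω n => X n ω - τ n ω) P :=
    aemeasurable_pi_iff.2 fun n => (h.hasLaw n).aemeasurable.sub (hτ n).aemeasurable
  have hlaw : P.map (fun ω n => X n ω - τ n ω)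
      = Measure.infinitePi fun _ : ℕ => netClaim lam G := by
    have h1 := (indepFun_iff_map_prod_eq_prod_map_map hτm hXm).1 hind
    rw [(hτi.hasLaw_infinitePi hτ hτm).map_eq, (h.iIndep.hasLaw_infinitePi h.hasLaw hXm).map_eq]
      at h1
    have h2 := map_sub_infinitePi (expMeasure lam) G
    rw [← h1, AEMeasurable.map_map_of_aemeasurable (by fun_prop) (hτm.prodMk hXm)] at h2
    exact h2
  have hae : {ω | ∃ t : ℝ≥0, reserve N X u t ω < 0}
      =ᵐ[P] (fun ω n => X n ω - τ n ω) ⁻¹' (stayBelow u)ᶜ := by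
    filter_upwards [hpos, hN] with ω h1 h2
    exact propext (exists_reserve_neg_iff (τ := fun n => τ n ω) (p := fun t => N t ω) h1 h2
      (fun n => X n ω) u)
  rw [ruinProbability, measureReal_congr hae, survival, ← probReal_compl_eq_one_sub
    (measurableSet_stayBelow u), ← hlaw, map_measureReal_apply_of_aemeasurable hYm
    (measurableSet_stayBelow u).compl]

end Model

/-! ### Mixtures of light-tailed and heavy-tailed claims -/

section Mixture

variable {ε : ℝ} {B C : Measure ℝ}

lemma isProbabilityMeasure_mixture [IsProbabilityMeasure B] [IsProbabilityMeasure C]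
    (h0 : 0 ≤ ε) (h1 : ε ≤ 1) : IsProbabilityMeasure (mixture ε B C) := ⟨by
  simp only [mixture, Measure.add_apply, Measure.smul_apply, measure_univ, smul_eq_mul, mul_one]
  rw [← ENNReal.ofReal_add (by linarith) h0, sub_add_cancel, ENNReal.ofReal_one]⟩

lemma integrable_mixture {f : ℝ → ℝ} (hB : Integrable f B) (hC : Integrable f C) :
    Integrable f (mixture ε B C) :=
  (hB.smul_measure ENNReal.ofReal_ne_top).add_measure (hC.smul_measure ENNReal.ofReal_ne_top)

lemma mean_mixture (h0 : 0 ≤ ε) (h1 : ε ≤ 1) (hB : Integrable (fun x => x) B)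
    (hC : Integrable (fun x => x) C) :
    mean (mixture ε B C) = (1 - ε) * mean B + ε * mean C := by
  rw [mean, mixture, integral_add_measure (hB.smul_measure ENNReal.ofReal_ne_top)
    (hC.smul_measure ENNReal.ofReal_ne_top), integral_smul_measure, integral_smul_measure,
    ENNReal.toReal_ofReal (by linarith), ENNReal.toReal_ofReal h0]
  rfl

lemma tail_mixture [IsFiniteMeasure B] [IsFiniteMeasure C] (h0 : 0 ≤ ε) (h1 : ε ≤ 1) (x : ℝ) :
    tail (mixture ε B C) x = (1 - ε) * tail B x + ε * tail C x := by
  have := B.smul_finite (c := ENNReal.ofReal (1 - ε)) ENNReal.ofReal_ne_top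
  have := C.smul_finite (c := ENNReal.ofReal ε) ENNReal.ofReal_ne_top
  rw [tail, mixture, measureReal_add_apply, measureReal_ennreal_smul_apply,
    measureReal_ennreal_smul_apply, ENNReal.toReal_ofReal (by linarith), ENNReal.toReal_ofReal h0]
  rfl

lemma ladderKernel_mixture [IsFiniteMeasure B] [IsFiniteMeasure C] {lam : ℝ} (hlam : 0 ≤ lam)
    (h0 : 0 ≤ ε) (h1 : ε ≤ 1) (hC : 0 < mean C) :
    ladderKernel lam (mixture ε B C) = ladderKernel (lam * (1 - ε)) B
      + ENNReal.ofReal (ε * (lam * mean C)) • stationaryExcess C := by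
  have hBm := measurable_tail B
  have hCm := measurable_tail C
  rw [ladderKernel, ladderKernel, stationaryExcess, ← withDensity_smul _ (by fun_prop),
    ← withDensity_add_left (by fun_prop)]
  congr 1
  funext x
  have hB0 := tail_nonneg B x
  have hC0 := tail_nonneg C x
  have h1' : 0 ≤ 1 - ε := by linarith
  simp only [Pi.add_apply, Pi.smul_apply, smul_eq_mul]
  rw [← ENNReal.ofReal_mul (by positivity), ← ENNReal.ofReal_add (by positivity) (by positivity),
    tail_mixture h0 h1]
  congr 1
  field_simp

lemma ladderKernel_Iio_zero {lam : ℝ} {G : Measure ℝ} : ladderKernel lam G (Set.Iio 0) = 0 := by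
  refine withDensity_absolutelyContinuous _ _ ?_
  rw [Measure.restrict_apply measurableSet_Iio]
  have : Set.Iio (0 : ℝ) ∩ Set.Ioi 0 = ∅ := by
    ext x; simp only [Set.mem_inter_iff, Set.mem_Iio, Set.mem_Ioi, Set.mem_empty_iff_false]
    constructor
    · rintro ⟨h, h'⟩; linarith
    · exact False.elim
  rw [this, measure_empty]

lemma integrable_exp_ladderKernel [IsFiniteMeasure B] {lam β : ℝ} (hlam : 0 ≤ lam) (hβ : 0 < β)
    (hB : ∀ x, 0 ≤ x → tail B x ≤ 2 * Real.exp (-(β * x))) :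
    Integrable (fun x => Real.exp (β / 2 * x)) (ladderKernel lam B) := by
  have hBm := measurable_tail B
  rw [ladderKernel, integrable_withDensity_iff (by fun_prop)
    (Eventually.of_forall fun x => ENNReal.ofReal_lt_top)]
  have hdom := (integrableOn_exp_mul_Ioi (a := -(β / 2)) (by linarith) 0).const_mul (lam * 2)
  refine Integrable.mono' hdom (by fun_prop) ?_
  filter_upwards [ae_restrict_mem measurableSet_Ioi] with x hx
  have hB0 := tail_nonneg B x
  rw [ENNReal.toReal_ofReal (by positivity), Real.norm_of_nonneg (by positivity)]
  calc Real.exp (β / 2 * x) * (lam * tail B x)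
      ≤ Real.exp (β / 2 * x) * (lam * (2 * Real.exp (-(β * x)))) := by
        gcongr; exact hB x (le_of_lt hx)
    _ = lam * 2 * (Real.exp (β / 2 * x) * Real.exp (-(β * x))) := by ring
    _ = lam * 2 * Real.exp (-(β / 2) * x) := by rw [← Real.exp_add]; ring_nf

lemma IsSubexponential.mean_pos [IsFiniteMeasure C] (hC0 : C (Set.Iio 0) = 0)
    (h : IsSubexponential (stationaryExcess C)) : 0 < mean C := by
  have hnn : 0 ≤ mean C := integral_nonneg_of_ae (ae_nonneg_of_measure_Iio hC0)
  refine lt_of_le_of_ne hnn fun h0 => ?_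
  -- division by a vanishing mean would make the stationary excess measure zero
  have hzero : stationaryExcess C = 0 := by
    simp [stationaryExcess, ← h0]
  have := h.tail_pos 0
  rw [hzero] at this
  simp [tail] at this

end Mixture

theorem theoremt {Ω : Type*} [MeasurableSpace Ω] (P : Measure Ω) [IsProbabilityMeasure P]
    (lam ε δ θ : ℝ) (hlam : 0 < lam) (hε₀ : 0 < ε) (hε₁ : ε ≤ 1)
    -- the laws of the phase-type claims `B` and of the heavy-tailed claims `C`
    (lawB lawC : Measure ℝ)
    (hB : IsPhaseType lawB) (hBmean : Integrable (fun x => x) lawB)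
    (hC : IsNonnegDistribution lawC) (hCmean : Integrable (fun x => x) lawC)
    (hδ : δ = lam * mean lawB) (hθ : θ = lam * mean lawC)
    (hρ : (1 - ε) * δ + ε * θ < 1)
    (N : ℝ≥0 → Ω → ℕ) (X : ℕ → Ω → ℝ)
    (hmodel : IsCramerLundberg N X lam (mixture ε lawB lawC) P)
    (hsub : IsSubexponential (stationaryExcess lawC)) :
    Tendsto
      (fun u : ℝ => ruinProbability P N X u /
        (ε * θ / (1 - δ + ε * δ - ε * θ) * tail (stationaryExcess lawC) u))
      atTop (𝓝 1)
 := by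
  have hBp := hB.1.isProbabilityMeasure
  have hCp := hC.isProbabilityMeasure
  have hGp : IsProbabilityMeasure (mixture ε lawB lawC) := isProbabilityMeasure_mixture hε₀.le hε₁
  have hG0 : mixture ε lawB lawC (Set.Iio 0) = 0 := by
    simp [mixture, hB.1.nonneg, hC.nonneg]
  have hGi : Integrable (fun x => x) (mixture ε lawB lawC) := integrable_mixture hBmean hCmean
  have hCpos : 0 < mean lawC := hsub.mean_pos hC.nonneg
  have hθpos : 0 < θ := hθ ▸ mul_pos hlam hCpos
  have hload : lam * mean (mixture ε lawB lawC) < 1 := by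
    rw [mean_mixture hε₀.le hε₁ hBmean hCmean]
    calc _ = (1 - ε) * δ + ε * θ := by rw [hδ, hθ]; ring
      _ < 1 := hρ
  have hlamε : 0 ≤ lam * (1 - ε) := mul_nonneg hlam.le (by linarith)
  have hκuniv := ladderKernel_univ hlamε hB.1.nonneg hBmean
  have hκfin : IsFiniteMeasure (ladderKernel (lam * (1 - ε)) lawB) :=
    ⟨by rw [hκuniv]; exact ENNReal.ofReal_lt_top⟩
  have hκreal : (ladderKernel (lam * (1 - ε)) lawB).real Set.univ = (1 - ε) * δ := by
    have hB0 : 0 ≤ mean lawB := integral_nonneg_of_ae (ae_nonneg_of_measure_Iio hB.1.nonneg)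
    rw [measureReal_def, hκuniv, ENNReal.toReal_ofReal (mul_nonneg hlamε hB0), hδ]
    ring
  obtain ⟨β, hβ, hdecay⟩ := hB.exists_tail_le
  have := isProbabilityMeasure_netClaim (G := mixture ε lawB lawC) hlam
  have hs0 := survival_nonneg (netClaim lam (mixture ε lawB lawC))
  have hs1 := survival_le_one (netClaim lam (mixture ε lawB lawC))
  have hlim := hsub.tendsto_of_renewal_equation (κ := ladderKernel (lam * (1 - ε)) lawB)
    (a := ε * θ) (ψ := fun u => 1 - survival (netClaim lam (mixture ε lawB lawC)) u)
    ladderKernel_Iio_zero (half_pos hβ) (integrable_exp_ladderKernel hlamε hβ hdecay)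
    (mul_pos hε₀ hθpos).le (by rw [hκreal]; exact hρ)
    ((measurable_survival _).const_sub 1) (fun u => by linarith [hs1 u])
    (fun u => by linarith [hs0 u]) (fun u hu => by rw [survival_of_neg _ hu, sub_zero])
    (fun u hu => by
      rw [hθ, ← ladderKernel_mixture hlam.le hε₀.le hε₁ hCpos]
      exact one_sub_survival_eq_integral hlam hG0 hGi hload hu)
  rw [hκreal] at hlim
  have hden : 1 - δ + ε * δ - ε * θ = 1 - ((1 - ε) * δ + ε * θ) := by ring
  have hc : 0 < ε * θ / (1 - ((1 - ε) * δ + ε * θ)) :=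
    div_pos (mul_pos hε₀ hθpos) (by linarith)
  rw [hden]
  have h := hlim.div_const (ε * θ / (1 - ((1 - ε) * δ + ε * θ)))
  rw [div_self hc.ne'] at h
  refine h.congr fun u => ?_
  rw [hmodel.ruinProbability_eq hlam, div_div, mul_comm (tail _ _)]
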